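/- **Setting.** Let $M\in GL(2,\mathbb Z)$ be primitive (some power $M^n$ has no zero entry) with eigenvalues $\lambda>1$ and $\mu$, $|\mu|<1$, and let $V$ and $W$ be the expanding and the contracting eigenline. Let $Y$ be the vertical axis of $\mathbb R^2$, identified with $\mathbb R$, let $\Pi_Y$ be the projection to $Y$ parallel to $V$ and $\Pi_V$ the projection to $V$ parallel to $W$. Put $\Lambda=\Pi_Y(\mathbb Z^2)$. For a bounded half-open interval $\Omega\subset Y$ of positive length $|\Omega|$ (a window), $\mathcal T_\Omega$ is the tiling of $V\cong\mathbb R$ by intervals with vertex set $\Pi_V(\mathbb Z^2\cap(V+\Omega))$. Let $\Omega,\Omega'\subset Y$ be windows with $|\Omega'|=|\Omega|$ and $\Pi_YM(\Omega)\subset\Omega'$. Assume that $\Pi_YM(\Omega)$ and $\Omega'$ are half-open on the same side, or that at least one of $\Omega$, $\Omega'$ is nonsingular, i.e. has no end point in $\Lambda$. Let $d_+$ and $d_-$ be the distances between the tops and between the bottoms of $\Pi_YM(\Omega)$ and $\Omega'$. A *substitution rule* has a finite protoset of labelled intervals; it inflates every tile by a factor and replaces each inflated prototile by a patch of prototiles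 covering it exactly. It is *associated to* $(\Omega,\Omega')$ if its factor is $\lambda$ and it maps some labelling of $\mathcal T_\Omega$ to a labelling of $\mathcal T_{\Omega'}$ such that the two labelled tilings are locally isomorphic. It (with this labelling of $\mathcal T_\Omega$) is *local* if for some $R$ the label of each tile is determined by the shape, without labels, of the $R$-neighbourhood of the left end point of the tile. It is *reduced* if any two different prototiles have, after some number of iterations of the rule, patches that differ even when labels are ignored. **Theorem.** Consider the condition (C) at least one of the following holds: * $(1-\lambda)|\Omega|,\ d_+,\ d_-\in\Lambda$; * $(-1-\lambda)|\Omega|,\ \lambda d_++|\Omega|,\ \lambda d_-+|\Omega|\in\Lambda$. 1. There is a local substitution rule associated to $(\Omega,\Omega')$ if and only if (C) holds. 2. For each reduced substitution rule associated to $(\Omega,\Omega')$ (with its labelling of $\mathcal T_\Omega$): the rule is local if and only if (C) holds. 3. (Lattice form.) Let $l,s\in\mathbb Q^2$ with $\Pi_Y(l)=|\Omega|$ and $\Pi_Y(s)=\Pi_Y(Mc)-c'$, where $c$ and $c'$ are the bottoms of $\Omega$ and $\Omega'$ (so that $\Pi_YM(\Omega)$ is, up to end points, $\Pi_YM([0,\Pi_Y(l)))+\Pi_Y(s)+c'$).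 There is a local substitution rule associated to $(\Omega,\Omega')$ if and only if * $l\in\mathbb Z^2$ and $s\in\mathbb Z^2$, or * $l-Ml\in\mathbb Z^2$ and $s\in\mathbb Z^2$, or * $l+Ml\in\mathbb Z^2$ and $s\in\mathbb Z^2+l$. 4. If the upper right entry of $M$ is $\pm1$, then $\Lambda=\mathbb Z[\lambda]$. -/

import Mathlib

open scoped Matrix

/-! Interval projection tilings.  The tiling space V and the window space W are the lines in the
plane spanned by vectors v and w; the space Y is the vertical coordinate axis, identified with the
real line through its vertical coordinate, and V is identified with the real line through the
coordinate with respect to its generator v. -/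

/-- The projection to the vertical axis Y parallel to V = span v: the height at which the line
through x parallel to v meets the vertical axis (for v not vertical). -/
noncomputable def projY (v x : Fin 2 → ℝ) : ℝ := x 1 - v 1 / v 0 * x 0

/-- The projection to V = span v parallel to W = span w, as a multiple of v. -/
noncomputable def projV (v w x : Fin 2 → ℝ) : ℝ :=
  (x 0 * w 1 - x 1 * w 0) / (v 0 * w 1 - v 1 * w 0)

theorem projY_spec (v x : Fin 2 → ℝ) (hv : v 0 ≠ 0) :
    x - ![0, projY v x] ∈ Submodule.span ℝ {v} := by
  refine Submodule.mem_span_singleton.2 ⟨x 0 / v 0, ?_⟩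
  ext i
  fin_cases i <;> simp [projY] <;> field_simp

theorem projV_spec (v w x : Fin 2 → ℝ) (h : v 0 * w 1 - v 1 * w 0 ≠ 0) :
    x - projV v w x • v ∈ Submodule.span ℝ {w} := by
  refine Submodule.mem_span_singleton.2
    ⟨(v 0 * x 1 - v 1 * x 0) / (v 0 * w 1 - v 1 * w 0), ?_⟩
  ext i
  fin_cases i <;> simp [projV] <;> field_simp <;> ring

/-- A vector of integers as a point of the plane. -/
def latticePoint (z : Fin 2 → ℤ) : Fin 2 → ℝ := fun i => (z i : ℝ)

/-- The projection of the integer lattice to Y. -/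
def latticeY (v : Fin 2 → ℝ) : Set ℝ := {y | ∃ z : Fin 2 → ℤ, projY v (latticePoint z) = y}

/-- The half-open interval in Y with bottom c and length L, closed at the bottom if the flag is
true and closed at the top otherwise. -/
def window (closedBelow : Bool) (c L : ℝ) : Set ℝ :=
  if closedBelow then Set.Ico c (c + L) else Set.Ioc c (c + L)

/-- The window with bottom c and length L is nonsingular: no lattice point projects to one of its
end points. -/
def Nonsingular (v : Fin 2 → ℝ) (c L : ℝ) : Prop := c ∉ latticeY v ∧ c + L ∉ latticeY v

/-- The vertices of the projection tiling with window Ω: the projections to V of the lattice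
points in the strip V + Ω. -/
def tilingVertices (v w : Fin 2 → ℝ) (Ω : Set ℝ) : Set ℝ :=
  {u | ∃ z : Fin 2 → ℤ, projY v (latticePoint z) ∈ Ω ∧ projV v w (latticePoint z) = u}

/-- The projection to Y of the image under M of the subset Ω of Y. -/
noncomputable def subwindow (M : Matrix (Fin 2) (Fin 2) ℤ) (v : Fin 2 → ℝ) (Ω : Set ℝ) : Set ℝ :=
  (fun y => projY v (M.map (Int.cast : ℤ → ℝ) *ᵥ ![0, y])) '' Ω

/-! Tilings of the line by labelled tiles and their substitution rules. -/

/-- A vertex hierarchic substitution rule on a protoset of labelled intervals, indexed by ι.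
The prototile a has length len a; after inflation by the factor it is replaced by the word rep a,
which covers it exactly.  Prototiles of equal length are told apart by their labels only. -/
structure SubstitutionRule (ι : Type) where
  len : ι → ℝ
  len_pos : ∀ a, 0 < len a
  factor : ℝ
  one_lt_factor : 1 < factor
  rep : ι → List ι
  covers : ∀ a, ((rep a).map len).sum = factor * len a

/-- The patch formed by the tiles of a word laid out side by side from the point x on.  A tile is
given by its left end point and its prototile. -/
def placeWord {ι : Type} (len : ι → ℝ) : ℝ → List ι → Set (ℝ × ι)
  | _, [] => ∅
  | x, a :: u => insert (x, a) (placeWord len (x + len a) u)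

namespace SubstitutionRule

variable {ι : Type} (σ : SubstitutionRule ι)

/-- The action of a substitution rule on a set of tiles: inflate, then replace. -/
def apply (T : Set (ℝ × ι)) : Set (ℝ × ι) :=
  {q | ∃ p ∈ T, q ∈ placeWord σ.len (σ.factor * p.1) (σ.rep p.2)}

/-- The word obtained from the prototile a by applying the rule n times. -/
def iter : ℕ → ι → List ι
  | 0, a => [a]
  | n + 1, a => (iter n a).flatMap σ.rep

/-- The rule has no superfluous labels: two prototiles for which, at every iteration, the patches
without their labels coincide are the same prototile. -/
def Reduced : Prop :=
  ∀ a b : ι, (∀ n : ℕ, (σ.iter n a).map σ.len = (σ.iter n b).map σ.len) → a = b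

end SubstitutionRule

/-- The interval from x to y is a tile of the geometric tiling with vertex set X. -/
def IsTile (X : Set ℝ) (x y : ℝ) : Prop :=
  x ∈ X ∧ y ∈ X ∧ x < y ∧ ∀ z ∈ X, ¬ (x < z ∧ z < y)

/-- T is a labelling of the geometric tiling with vertex set X by prototiles of matching length:
each vertex is the left end point of exactly one tile of T, and all tiles of T arise so. -/
def IsLabelling {ι : Type} (len : ι → ℝ) (X : Set ℝ) (T : Set (ℝ × ι)) : Prop :=
  (∀ x ∈ X, ∃! a, (x, a) ∈ T) ∧ ∀ p ∈ T, IsTile X p.1 (p.1 + len p.2)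

/-- Every finite set of labelled tiles of S occurs, up to a translation, in T. -/
def PatchesOccurIn {ι : Type} (S T : Set (ℝ × ι)) : Prop :=
  ∀ P : Set (ℝ × ι), P.Finite → P ⊆ S → ∃ t : ℝ, ∀ p ∈ P, (p.1 + t, p.2) ∈ T

/-- Two labelled tilings are locally isomorphic. -/
def LocallyIsomorphic {ι : Type} (S T : Set (ℝ × ι)) : Prop :=
  PatchesOccurIn S T ∧ PatchesOccurIn T S

/-- The rule σ, acting on the labelled tiling T, is a substitution rule with inflation factor lam
associated to the window pair Ω, Ω₂: T is a labelling of the projection tiling with window Ω, its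
image is a labelling of the projection tiling with window Ω₂, and the two labelled tilings are
locally isomorphic. -/
structure IsRuleFor {ι : Type} (v w : Fin 2 → ℝ) (lam : ℝ) (Ω Ω₂ : Set ℝ)
    (σ : SubstitutionRule ι) (T : Set (ℝ × ι)) : Prop where
  factor_eq : σ.factor = lam
  source : IsLabelling σ.len (tilingVertices v w Ω) T
  target : IsLabelling σ.len (tilingVertices v w Ω₂) (σ.apply T)
  locIso : LocallyIsomorphic T (σ.apply T)

/-- The vertices of X at distance at most R from x, relative to x: the shape (without labels) of
the R-neighbourhood of x. -/
def neighbourhoodShape (X : Set ℝ) (R x : ℝ) : Set ℝ := {h | |h| ≤ R ∧ x + h ∈ X}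

/-- In the labelled tiling T with vertex set X, the label of every tile is determined by the shape
of a neighbourhood of uniformly bounded size. -/
def IsLocal {ι : Type} (X : Set ℝ) (T : Set (ℝ × ι)) : Prop :=
  ∃ R : ℝ, ∀ p ∈ T, ∀ q ∈ T,
    neighbourhoodShape X R p.1 = neighbourhoodShape X R q.1 → p.2 = q.2

/-- The window pair admits a local substitution rule on a finite protoset. -/
def AdmitsLocalRule (v w : Fin 2 → ℝ) (lam : ℝ) (Ω Ω₂ : Set ℝ) : Prop :=
  ∃ (ι : Type) (_ : Finite ι) (σ : SubstitutionRule ι) (T : Set (ℝ × ι)),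
    IsRuleFor v w lam Ω Ω₂ σ T ∧ IsLocal (tilingVertices v w Ω) T

/-! The arithmetic conditions. -/

/-- Distance between the tops of two bounded windows. -/
noncomputable def topDist (A B : Set ℝ) : ℝ := |sSup A - sSup B|

/-- Distance between the bottoms of two bounded windows. -/
noncomputable def bottomDist (A B : Set ℝ) : ℝ := |sInf A - sInf B|

/-- The arithmetic condition on the window length L and on the distances dp and dm between the
tops and between the bottoms. -/
def LengthCondition (v : Fin 2 → ℝ) (lam L dp dm : ℝ) : Prop :=
  ((1 - lam) * L ∈ latticeY v ∧ dp ∈ latticeY v ∧ dm ∈ latticeY v) ∨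
  ((-1 - lam) * L ∈ latticeY v ∧ lam * dp + L ∈ latticeY v ∧ lam * dm + L ∈ latticeY v)

/-- The rational vector x lies in the integer lattice. -/
def IsLatticeVector (x : Fin 2 → ℚ) : Prop := ∃ z : Fin 2 → ℤ, ∀ i, x i = z i

/-- The arithmetic condition on the window vector l and the subwindow translation s. -/
def LatticeCondition (M : Matrix (Fin 2) (Fin 2) ℤ) (l s : Fin 2 → ℚ) : Prop :=
  (IsLatticeVector l ∧ IsLatticeVector s) ∨
  (IsLatticeVector (l - M.map (Int.cast : ℤ → ℚ) *ᵥ l) ∧ IsLatticeVector s) ∨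
  (IsLatticeVector (l + M.map (Int.cast : ℤ → ℚ) *ᵥ l) ∧ IsLatticeVector (s - l))

/-! A lattice point carries two coordinates: `projV`, which M multiplies by λ, and `projY`, which M
multiplies by μ. It gives a vertex when its Y-coordinate lies in the window. The shape of a bounded
neighbourhood of a vertex therefore records only on which side of finitely many lattice translates
of the window ends its Y-coordinate lies. The patch above the inflated tile is governed in the same
way by lattice translates of the ends of Ω' divided by μ. Everything hinges on `IsEndImage`: each
end of Ω' must differ from μ times an end of Ω by an element of Λ.

If both ends satisfy this, shapes of radius R/λ + K in the source determine shapes of radius R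
around inflated vertices (`derivesShapes`). As λ > 1, a large enough radius reproduces itself, so
labelling tiles by their shapes gives a local rule (`exists_local_rule`). In a reduced rule, labels
are recovered from the unlabelled iterated patches, which are again determined by shapes
(`isLocal_of_reduced`).

If an end e of Ω' violates it, take lattice points with Y-coordinates just inside and just outside
Ω' at e. The tile whose patch contains the first has a copy, with the same shape and hence the same
label, placed so that its patch would contain the second, which is no vertex
(`isEndImage_of_isLocal`).

There remain four ways to match the two ends of Ω' with ends of Ω. Since multiplication by μ
permutes Λ, they translate into the two arithmetic conditions (`isEndImage_iff_lengthCondition`,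
`isEndImage_iff_latticeCondition`). -/

/-! ### Shapes, tiles and words in Delone sets. -/

theorem neighbourhoodShape_eq_iff {X X' : Set ℝ} {R x x' : ℝ} :
    neighbourhoodShape X R x = neighbourhoodShape X' R x' ↔
      ∀ h, |h| ≤ R → (x + h ∈ X ↔ x' + h ∈ X') := by
  simp only [neighbourhoodShape, Set.ext_iff, Set.mem_ofPred_eq]
  exact forall_congr' fun h => and_congr_right_iff

theorem neighbourhoodShape_eq_mono {X X' : Set ℝ} {R r x x' : ℝ} (hr : r ≤ R)
    (h : neighbourhoodShape X R x = neighbourhoodShape X' R x') :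
    neighbourhoodShape X r x = neighbourhoodShape X' r x' :=
  neighbourhoodShape_eq_iff.2 fun k hk => neighbourhoodShape_eq_iff.1 h k (hk.trans hr)

theorem IsTile.unique {X : Set ℝ} {x y z : ℝ} (hy : IsTile X x y) (hz : IsTile X x z) :
    y = z := by
  obtain ⟨-, hyX, hxy, hy'⟩ := hy
  obtain ⟨-, hzX, hxz, hz'⟩ := hz
  by_contra hne
  rcases lt_or_gt_of_ne hne with h | h
  · exact hz' y hyX ⟨hxy, h⟩
  · exact hy' z hzX ⟨hxz, h⟩

/-- A tile is found again wherever the vertex set looks the same. -/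
theorem IsTile.transfer {X X' : Set ℝ} {x x' d : ℝ} (ht : IsTile X x (x + d))
    (h : ∀ k, 0 ≤ k → k ≤ d → (x + k ∈ X ↔ x' + k ∈ X')) : IsTile X' x' (x' + d) := by
  obtain ⟨h1, h2, h3, h4⟩ := ht
  have hd : 0 < d := by linarith
  refine ⟨by simpa using (h 0 le_rfl hd.le).1 (by simpa using h1), (h d hd.le le_rfl).1 h2,
    by linarith, fun z hz hlt => ?_⟩
  refine h4 (x + (z - x')) ((h _ (by linarith [hlt.1]) (by linarith [hlt.2])).2
    (by simpa using hz)) ⟨by linarith [hlt.1], by linarith [hlt.2]⟩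

/-- The set is locally finite and relatively dense. -/
structure IsDelone (X : Set ℝ) : Prop where
  finite : ∀ a b : ℝ, (X ∩ Set.Icc a b).Finite
  dense : ∃ G : ℝ, ∀ r : ℝ, ∃ x ∈ X, r < x ∧ x ≤ r + G

theorem IsDelone.exists_next {X : Set ℝ} (hX : IsDelone X) :
    ∃ G : ℝ, 0 ≤ G ∧ ∀ r : ℝ, ∃ y ∈ X, r < y ∧ y ≤ r + G ∧ ∀ z ∈ X, ¬ (r < z ∧ z < y) := by
  obtain ⟨G, hG⟩ := hX.dense
  refine ⟨G, ?_, fun r => ?_⟩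
  · obtain ⟨x, -, h1, h2⟩ := hG 0
    linarith
  · obtain ⟨x, hx, h1, h2⟩ := hG r
    have hfin : (X ∩ Set.Ioc r (r + G)).Finite :=
      (hX.finite r (r + G)).subset (Set.inter_subset_inter_right _ Set.Ioc_subset_Icc_self)
    obtain ⟨y, hy, hmin⟩ := Set.exists_min_image _ id hfin ⟨x, hx, h1, h2⟩
    refine ⟨y, hy.1, hy.2.1, hy.2.2, fun z hz hlt => ?_⟩
    have := hmin z ⟨hz, hlt.1, hlt.2.le.trans hy.2.2⟩
    simp only [id] at this
    linarith [hlt.2]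

theorem IsDelone.exists_prev {X : Set ℝ} (hX : IsDelone X) (r : ℝ) :
    ∃ x ∈ X, x ≤ r ∧ ∀ z ∈ X, ¬ (x < z ∧ z ≤ r) := by
  obtain ⟨G, hG⟩ := hX.dense
  obtain ⟨x, hx, h1, h2⟩ := hG (r - G)
  have hfin : (X ∩ Set.Icc (r - G) r).Finite := hX.finite _ _
  obtain ⟨y, hy, hmax⟩ := Set.exists_max_image _ id hfin ⟨x, hx, h1.le, by linarith⟩
  refine ⟨y, hy.1, hy.2.2, fun z hz hlt => ?_⟩
  have := hmax z ⟨hz, hy.2.1.trans hlt.1.le, hlt.2⟩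
  simp only [id] at this
  linarith [hlt.1]

theorem mem_placeWord_add {ι : Type} (len : ι → ℝ) (u : List ι) (x t : ℝ) (q : ℝ × ι) :
    q ∈ placeWord len (x + t) u ↔ (q.1 - t, q.2) ∈ placeWord len x u := by
  induction u generalizing x with
  | nil => simp [placeWord]
  | cons a u ih =>
    have h : x + t + len a = x + len a + t := by ring
    simp only [placeWord, Set.mem_insert_iff, h, ih]
    refine or_congr_left ?_
    obtain ⟨q1, q2⟩ := q
    simp only [Prod.mk.injEq, sub_eq_iff_eq_add]

theorem le_of_mem_placeWord {ι : Type} {len : ι → ℝ} (hlen : ∀ a, 0 < len a) (u : List ι)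
    (x : ℝ) (q : ℝ × ι) (hq : q ∈ placeWord len x u) :
    x ≤ q.1 ∧ q.1 < x + (u.map len).sum := by
  induction u generalizing x with
  | nil => simp [placeWord] at hq
  | cons a u ih =>
    simp only [placeWord, Set.mem_insert_iff] at hq
    simp only [List.map_cons, List.sum_cons]
    have h0 : 0 ≤ (u.map len).sum :=
      List.sum_nonneg fun y hy => by
        obtain ⟨b, -, rfl⟩ := List.mem_map.1 hy
        exact (hlen b).le
    rcases hq with rfl | hq
    · exact ⟨le_rfl, by linarith [hlen a]⟩
    · have := ih _ hq
      exact ⟨by linarith [hlen a], by linarith⟩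

/-- The tiles of a labelled tiling between two vertices form a word. -/
theorem IsDelone.exists_word {ι : Type} {X : Set ℝ} (hX : IsDelone X) (len : ι → ℝ)
    (l : ℝ → ι) (hl : ∀ x ∈ X, IsTile X x (x + len (l x))) {y : ℝ} (hy : y ∈ X) :
    ∀ x ∈ X, x ≤ y → ∃ u : List ι, (∀ q : ℝ × ι, q ∈ placeWord len x u ↔
      q.1 ∈ X ∧ x ≤ q.1 ∧ q.1 < y ∧ q.2 = l q.1) ∧ (u.map len).sum = y - x := by
  suffices H : ∀ n : ℕ, ∀ x ∈ X, x ≤ y → (X ∩ Set.Icc x y).ncard = n → ∃ u : List ι,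
      (∀ q : ℝ × ι, q ∈ placeWord len x u ↔
      q.1 ∈ X ∧ x ≤ q.1 ∧ q.1 < y ∧ q.2 = l q.1) ∧ (u.map len).sum = y - x from
    fun x hx hxy => H _ x hx hxy rfl
  intro n
  induction n using Nat.strong_induction_on with
  | _ n ih =>
    intro x hx hxy hn
    rcases hxy.eq_or_lt with rfl | hlt
    · refine ⟨[], fun q => ?_, by simp⟩
      simp only [placeWord, Set.mem_empty_iff_false, false_iff]
      rintro ⟨-, h1, h2, -⟩
      linarith
    · obtain ⟨-, h2, h3, h4⟩ := hl x hx
      have hle : x + len (l x) ≤ y := by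
        by_contra hcon
        exact h4 y hy ⟨hlt, not_le.1 hcon⟩
      have hcard : (X ∩ Set.Icc (x + len (l x)) y).ncard < n := by
        rw [← hn]
        refine Set.ncard_lt_ncard ?_ (hX.finite _ _)
        refine ⟨fun z hz => ⟨hz.1, h3.le.trans hz.2.1, hz.2.2⟩, fun hsub => ?_⟩
        have := (hsub ⟨hx, le_rfl, hxy⟩).2.1
        linarith
      obtain ⟨u, hu, hs⟩ := ih _ hcard _ h2 hle rfl
      refine ⟨l x :: u, fun q => ?_, by simp only [List.map_cons, List.sum_cons, hs]; ring⟩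
      simp only [placeWord, Set.mem_insert_iff, hu]
      constructor
      · rintro (rfl | ⟨ha, hb, hc, hd⟩)
        · exact ⟨hx, le_rfl, hlt, rfl⟩
        · exact ⟨ha, by linarith, hc, hd⟩
      · rintro ⟨ha, hb, hc, hd⟩
        rcases hb.eq_or_lt with hb | hb
        · left
          ext
          · exact hb.symm
          · rw [hd, ← hb]
        · right
          refine ⟨ha, ?_, hc, hd⟩
          by_contra hcon
          exact h4 q.1 ha ⟨hb, not_le.1 hcon⟩

/-! ### Local rules from shapes. -/

/-- The shape of a neighbourhood of the vertex x of X determines the shape of a neighbourhood of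
the point lam * x in X₂, uniformly. -/
def DerivesShapes (lam K : ℝ) (X X₂ : Set ℝ) : Prop :=
  ∀ R : ℝ, ∀ x ∈ X, ∀ y ∈ X,
    neighbourhoodShape X (R / lam + K) x = neighbourhoodShape X (R / lam + K) y →
    neighbourhoodShape X₂ R (lam * x) = neighbourhoodShape X₂ R (lam * y)

/-- Every bounded part of X occurs, up to a translation, in X₂. -/
def ShapesOccurIn (X X₂ : Set ℝ) : Prop :=
  ∀ R : ℝ, ∃ t : ℝ, ∀ u, |u| ≤ R → (u ∈ X ↔ u + t ∈ X₂)

/-- X has finitely many neighbourhood shapes of each size. -/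
def HasFiniteComplexity (X : Set ℝ) : Prop :=
  ∀ R : ℝ, ∃ F : Set ℝ, F.Finite ∧ ∀ x ∈ X, neighbourhoodShape X R x ⊆ F

theorem ShapesOccurIn.exists_shape {X X₂ : Set ℝ} (h : ShapesOccurIn X X₂) (R B : ℝ) :
    ∃ t, ∀ x ∈ X, |x| ≤ B →
      x + t ∈ X₂ ∧ neighbourhoodShape X R x = neighbourhoodShape X₂ R (x + t) := by
  obtain ⟨t, ht⟩ := h (B + |R|)
  refine ⟨t, fun x hx hxB => ⟨(ht x (by linarith [abs_nonneg R])).1 hx, ?_⟩⟩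
  refine neighbourhoodShape_eq_iff.2 fun k hk => ?_
  rw [ht (x + k) ((abs_add_le _ _).trans (by linarith [le_abs_self R])), add_right_comm]

/-- A label encodes an R-shape faithfully, so a translation matching the vertex sets on a
sufficiently enlarged region also matches labels. -/
theorem patchesOccurIn_of_shapes {ι : Type} {X X₂ : Set ℝ} {R : ℝ} (h : ShapesOccurIn X X₂)
    {f : ι → Set ℝ} (hf : Function.Injective f) {l l₂ : ℝ → ι}
    (hl : ∀ x ∈ X, f (l x) = neighbourhoodShape X R x)
    (hl₂ : ∀ x ∈ X₂, f (l₂ x) = neighbourhoodShape X₂ R x) :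
    PatchesOccurIn {q : ℝ × ι | q.1 ∈ X ∧ q.2 = l q.1} {q : ℝ × ι | q.1 ∈ X₂ ∧ q.2 = l₂ q.1} := by
  intro P hP hsub
  obtain ⟨B, hB⟩ := (hP.image fun q => |q.1|).bddAbove
  obtain ⟨t, ht⟩ := h.exists_shape R B
  refine ⟨t, fun p hp => ?_⟩
  obtain ⟨h1, h2⟩ := hsub hp
  obtain ⟨h3, h4⟩ := ht p.1 h1 (hB ⟨p, hp, rfl⟩)
  refine ⟨h3, ?_⟩
  rw [h2]
  apply hf
  rw [hl _ h1, hl₂ _ h3, h4]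

/-- Labelling each tile by the shape of a large neighbourhood gives a local rule. -/
theorem exists_local_rule {X X₂ : Set ℝ} {lam K : ℝ} (hlam : 1 < lam) (hX : IsDelone X)
    (hX₂ : IsDelone X₂) (hfc : HasFiniteComplexity X) (hincl : ∀ x ∈ X, lam * x ∈ X₂)
    (hder : DerivesShapes lam K X X₂) (h12 : ShapesOccurIn X X₂) (h21 : ShapesOccurIn X₂ X) :
    ∃ (ι : Type) (_ : Finite ι) (σ : SubstitutionRule ι) (T : Set (ℝ × ι)),
      σ.factor = lam ∧ IsLabelling σ.len X T ∧ IsLabelling σ.len X₂ (σ.apply T) ∧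
      LocallyIsomorphic T (σ.apply T) ∧ IsLocal X T := by
  have hlam0 : 0 < lam := by linarith
  obtain ⟨G, hG0, hG⟩ := hX.exists_next
  -- An inflated tile has length at most `lam * G`; the R-shapes of all its vertices are visible at
  -- radius `lam * G + R`. The second inequality makes the R-shape of the original tile determine
  -- these; it is solvable because `lam > 1`. The first lets a label reveal the length of its tile.
  obtain ⟨R, hRG, hR⟩ : ∃ R, G ≤ R ∧ (lam * G + R) / lam + K ≤ R := by
    refine ⟨max G ((G + K) * lam / (lam - 1)), le_max_left _ _, ?_⟩
    have h1 := le_max_right G ((G + K) * lam / (lam - 1))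
    set R := max G ((G + K) * lam / (lam - 1))
    rw [div_le_iff₀ (by linarith)] at h1
    rw [← le_sub_iff_add_le, div_le_iff₀ hlam0]
    linarith
  let ι : Type := {S : Set ℝ // ∃ x ∈ X, neighbourhoodShape X R x = S}
  have hfin : Finite ι := by
    obtain ⟨F, hF, hsub⟩ := hfc R
    have : {S : Set ℝ | ∃ x ∈ X, neighbourhoodShape X R x = S}.Finite := by
      refine hF.finite_subsets.subset ?_
      rintro S ⟨x, hx, rfl⟩
      exact hsub x hx
    exact this.to_subtype
  -- The target shows no new shapes, so the protoset read off from X also labels X₂.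
  have hsub : ∀ x ∈ X₂, ∃ y ∈ X, neighbourhoodShape X R y = neighbourhoodShape X₂ R x := by
    intro x hx
    obtain ⟨t, ht⟩ := h21.exists_shape R |x|
    exact ⟨x + t, (ht x hx le_rfl).1, (ht x hx le_rfl).2.symm⟩
  obtain ⟨x₀, hx₀, -⟩ := hX.exists_prev 0
  -- Outside X the label is arbitrary; that of `x₀` serves as default.
  have hl : ∃ l : ℝ → ι, ∀ x ∈ X, (l x).1 = neighbourhoodShape X R x := by
    have : ∀ x, ∃ a : ι, x ∈ X → a.1 = neighbourhoodShape X R x := by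
      intro x
      by_cases hx : x ∈ X
      · exact ⟨⟨_, x, hx, rfl⟩, fun _ => rfl⟩
      · exact ⟨⟨_, x₀, hx₀, rfl⟩, fun h => absurd h hx⟩
    choose l hl using this
    exact ⟨l, hl⟩
  have hl₂ : ∃ l : ℝ → ι, ∀ x ∈ X₂, (l x).1 = neighbourhoodShape X₂ R x := by
    have : ∀ x, ∃ a : ι, x ∈ X₂ → a.1 = neighbourhoodShape X₂ R x := by
      intro x
      by_cases hx : x ∈ X₂
      · exact ⟨⟨_, hsub x hx⟩, fun _ => rfl⟩
      · exact ⟨⟨_, x₀, hx₀, rfl⟩, fun h => absurd h hx⟩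
    choose l hl using this
    exact ⟨l, hl⟩
  obtain ⟨l, hl⟩ := hl
  obtain ⟨l₂, hl₂⟩ := hl₂
  have hξ : ∀ a : ι, ∃ x ∈ X, neighbourhoodShape X R x = a.1 := fun a => a.2
  choose ξ hξX hξ using hξ
  have hlen : ∀ a : ι, ∃ d, d ≤ G ∧ IsTile X (ξ a) (ξ a + d) := by
    intro a
    obtain ⟨y, hy, h1, h2, h3⟩ := hG (ξ a)
    refine ⟨y - ξ a, by linarith, ?_⟩
    rw [add_sub_cancel]
    exact ⟨hξX a, hy, h1, h3⟩
  choose len hlenG hlen using hlen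
  have hlen0 : ∀ a, 0 < len a := fun a => by linarith [(hlen a).2.2.1]
  have tile_of_shape : ∀ (Z : Set ℝ) (x : ℝ) (a : ι), a.1 = neighbourhoodShape Z R x →
      IsTile Z x (x + len a) := by
    intro Z x a ha
    refine (hlen a).transfer fun k hk hk' => ?_
    refine neighbourhoodShape_eq_iff.1 ((hξ a).trans ha) k ?_
    rw [abs_of_nonneg hk]
    linarith [hlenG a]
  have tile₁ : ∀ x ∈ X, IsTile X x (x + len (l x)) := fun x hx => tile_of_shape X x _ (hl x hx)
  have tile₂ : ∀ x ∈ X₂, IsTile X₂ x (x + len (l₂ x)) :=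
    fun x hx => tile_of_shape X₂ x _ (hl₂ x hx)
  -- The replacement word is read off above one chosen tile `ξ a` with label `a`; `hplace` shows
  -- that every other tile with this label gives the same word.
  have hrep : ∀ a : ι, ∃ u : List ι, (∀ q : ℝ × ι, q ∈ placeWord len (lam * ξ a) u ↔
      q.1 ∈ X₂ ∧ lam * ξ a ≤ q.1 ∧ q.1 < lam * (ξ a + len a) ∧ q.2 = l₂ q.1) ∧
      (u.map len).sum = lam * len a := by
    intro a
    obtain ⟨u, hu, hs⟩ := hX₂.exists_word len l₂ tile₂ (hincl _ (hlen a).2.1) _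
      (hincl _ (hξX a)) (mul_le_mul_of_nonneg_left (by linarith [hlen0 a]) hlam0.le)
    exact ⟨u, hu, by rw [hs]; ring⟩
  choose rep hrep hcov using hrep
  let σ : SubstitutionRule ι := ⟨len, hlen0, lam, hlam, rep, hcov⟩
  have hplace : ∀ x ∈ X, ∀ q : ℝ × ι, q ∈ placeWord len (lam * x) (rep (l x)) ↔
      q.1 ∈ X₂ ∧ lam * x ≤ q.1 ∧ q.1 < lam * (x + len (l x)) ∧ q.2 = l₂ q.1 := by
    intro x hx q
    set a := l x with ha
    have hshape : neighbourhoodShape X₂ (lam * G + R) (lam * x) =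
        neighbourhoodShape X₂ (lam * G + R) (lam * ξ a) := by
      refine hder _ x hx _ (hξX a) (neighbourhoodShape_eq_mono hR ?_)
      rw [hξ a, ha, hl x hx]
    rw [neighbourhoodShape_eq_iff] at hshape
    rw [show lam * x = lam * ξ a + (lam * x - lam * ξ a) by ring, mem_placeWord_add, hrep]
    simp only
    set h := q.1 - lam * x with hh
    have e1 : q.1 - (lam * x - lam * ξ a) = lam * ξ a + h := by rw [hh]; ring
    have e2 : q.1 = lam * x + h := by rw [hh]; ring
    rw [e1, e2]
    have hGlen := mul_le_mul_of_nonneg_left (hlenG a) hlam0.le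
    have key : 0 ≤ h → h < lam * len a →
        (lam * ξ a + h ∈ X₂ ↔ lam * x + h ∈ X₂) ∧
        (lam * ξ a + h ∈ X₂ → lam * x + h ∈ X₂ → l₂ (lam * ξ a + h) = l₂ (lam * x + h)) := by
      intro h0 h1
      refine ⟨(hshape h (by rw [abs_of_nonneg h0]; linarith)).symm, fun ha hb => ?_⟩
      apply Subtype.ext
      rw [hl₂ _ ha, hl₂ _ hb, neighbourhoodShape_eq_iff]
      intro k hk
      rw [add_assoc, add_assoc]
      refine (hshape _ ((abs_add_le _ _).trans ?_)).symm
      rw [abs_of_nonneg h0]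
      linarith
    constructor
    · rintro ⟨h1, h2, h3, h4⟩
      obtain ⟨k1, k2⟩ := key (by linarith) (by linarith)
      have hm := k1.1 h1
      exact ⟨hm, by linarith, by linarith, h4.trans (k2 h1 hm)⟩
    · rintro ⟨h1, h2, h3, h4⟩
      obtain ⟨k1, k2⟩ := key (by linarith) (by linarith)
      have hm := k1.2 h1
      exact ⟨hm, by linarith, by linarith, h4.trans (k2 hm h1).symm⟩
  let T : Set (ℝ × ι) := {q | q.1 ∈ X ∧ q.2 = l q.1}
  have happ : σ.apply T = {q | q.1 ∈ X₂ ∧ q.2 = l₂ q.1} := by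
    ext q
    constructor
    · rintro ⟨p, ⟨hp, hp2⟩, hq⟩
      rw [hp2] at hq
      have := (hplace p.1 hp q).1 hq
      exact ⟨this.1, this.2.2.2⟩
    · rintro ⟨hq, hq2⟩
      obtain ⟨x, hx, hle, hmax⟩ := hX.exists_prev (q.1 / lam)
      refine ⟨(x, l x), ⟨hx, rfl⟩, (hplace x hx q).2 ⟨hq, ?_, ?_, hq2⟩⟩
      · rw [le_div_iff₀ hlam0] at hle
        linarith
      · by_contra hcon
        refine hmax _ (tile₁ x hx).2.1 ⟨(tile₁ x hx).2.2.1, ?_⟩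
        rw [le_div_iff₀ hlam0]
        linarith
  refine ⟨ι, hfin, σ, T, rfl, ⟨fun x hx => ⟨l x, ⟨hx, rfl⟩, fun b hb => hb.2⟩, ?_⟩, ?_, ?_, R, ?_⟩
  · rintro ⟨x, a⟩ ⟨hx, ha⟩
    obtain rfl : a = l x := ha
    exact tile₁ x hx
  · rw [happ]
    refine ⟨fun x hx => ⟨l₂ x, ⟨hx, rfl⟩, fun b hb => hb.2⟩, ?_⟩
    rintro ⟨x, a⟩ ⟨hx, ha⟩
    obtain rfl : a = l₂ x := ha
    exact tile₂ x hx
  · rw [happ]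
    exact ⟨patchesOccurIn_of_shapes h12 Subtype.val_injective hl hl₂,
      patchesOccurIn_of_shapes h21 Subtype.val_injective hl₂ hl⟩
  · rintro ⟨x, a⟩ ⟨hx, ha⟩ ⟨y, b⟩ ⟨hy, hb⟩ hxy
    obtain rfl : a = l x := ha
    obtain rfl : b = l y := hb
    apply Subtype.ext
    rw [hl x hx, hl y hy]
    exact hxy

/-! ### Locality of reduced rules. -/

/-- A labelled tiling whose patches occur in T has the vertex neighbourhoods of T. -/
theorem exists_shape_of_patchesOccurIn {ι : Type} [Finite ι] {len : ι → ℝ}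
    (hlen : ∀ a, 0 < len a) {X X₂ : Set ℝ} {S T : Set (ℝ × ι)} (hX₂ : IsDelone X₂)
    (hT : IsLabelling len X T) (hS : IsLabelling len X₂ S) (hST : PatchesOccurIn S T)
    (R : ℝ) {p : ℝ × ι} (hp : p ∈ S) :
    ∃ q ∈ T, q.2 = p.2 ∧ neighbourhoodShape X R q.1 = neighbourhoodShape X₂ R p.1 := by
  obtain ⟨B, hB⟩ := (Set.finite_range len).bddAbove
  have hB' : ∀ a, len a ≤ B := fun a => hB ⟨a, rfl⟩
  have hB0 : 0 ≤ B := (hlen p.2).le.trans (hB' _)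
  -- The extra margin `B` on the left includes the tile that covers the left end of the
  -- neighbourhood.
  let P : Set (ℝ × ι) := {q | q ∈ S ∧ q.1 ∈ Set.Icc (p.1 - |R| - B) (p.1 + |R|)}
  have hP : P.Finite := by
    refine ((hX₂.finite (p.1 - |R| - B) (p.1 + |R|)).prod (Set.finite_univ (α := ι))).subset ?_
    rintro q ⟨hq, hq'⟩
    exact ⟨⟨(hS.2 q hq).1, hq'⟩, trivial⟩
  obtain ⟨t, ht⟩ := hST P hP fun q hq => hq.1
  refine ⟨(p.1 + t, p.2), ht p ⟨hp, by constructor <;> linarith [abs_nonneg R]⟩, rfl, ?_⟩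
  rw [neighbourhoodShape_eq_iff]
  intro h hh
  have h1 := abs_le.1 (hh.trans (le_abs_self R))
  constructor
  · intro hX
    -- A vertex of X whose counterpart is not in X₂ would fall inside the translate of a tile of S,
    -- which is a tile of T.
    obtain ⟨x, hx, hle, hmax⟩ := hX₂.exists_prev (p.1 + h)
    obtain ⟨a, ha, -⟩ := hS.1 x hx
    have htile := hS.2 _ ha
    have hlt : p.1 + h < x + len a := by
      by_contra hcon
      exact hmax _ htile.2.1 ⟨htile.2.2.1, not_lt.1 hcon⟩
    have hmem := hT.2 _ (ht (x, a) ⟨ha, by constructor <;> simp only <;> linarith [hB' a]⟩)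
    rcases hle.eq_or_lt with rfl | hlt'
    · exact hx
    · refine absurd ⟨?_, ?_⟩ (hmem.2.2.2 _ hX) <;> simp only <;> linarith
  · intro hX
    obtain ⟨a, ha, -⟩ := hS.1 _ hX
    have := (hT.2 _ (ht _ ⟨ha, by constructor <;> simp only <;> linarith⟩)).1
    simpa [add_right_comm] using this

/-- Splitting off the first application rather than the last lets an induction compare the tiles of
the once-substituted patches. -/
theorem SubstitutionRule.iter_succ' {ι : Type} (σ : SubstitutionRule ι) (n : ℕ) (a : ι) :
    σ.iter (n + 1) a = (σ.rep a).flatMap (σ.iter n) := by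
  induction n generalizing a with
  | zero => simp [SubstitutionRule.iter]
  | succ n ih =>
    change (σ.iter (n + 1) a).flatMap σ.rep = _
    rw [ih, List.flatMap_assoc]
    rfl

theorem flatMap_map_eq_of_forall₂ {α β γ : Type*} {f : α → List β} {g : β → γ} {u u' : List α}
    (h : List.Forall₂ (fun a b => (f a).map g = (f b).map g) u u') :
    (u.flatMap f).map g = (u'.flatMap f).map g := by
  induction h with
  | nil => rfl
  | cons h _ ih => simp only [List.flatMap_cons, List.map_append, h, ih]

/-- Two words of the same total length in parts of a tiling that look the same consist of tiles
with the same neighbourhoods. -/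
theorem forall₂_of_same_shape {ι : Type} {len : ι → ℝ} (hlen : ∀ a, 0 < len a) {X : Set ℝ}
    {S : Set (ℝ × ι)} {R : ℝ} (hS : IsLabelling len X S) (hR : 0 ≤ R) {r : ι → ι → Prop}
    (hr : ∀ p ∈ S, ∀ q ∈ S, neighbourhoodShape X R p.1 = neighbourhoodShape X R q.1 →
      r p.2 q.2) (u : List ι) :
    ∀ (u' : List ι) (x x' : ℝ), placeWord len x u ⊆ S → placeWord len x' u' ⊆ S →
      (u.map len).sum = (u'.map len).sum →
      (∀ h, -R ≤ h → h ≤ (u.map len).sum + R → (x + h ∈ X ↔ x' + h ∈ X)) →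
      List.Forall₂ r u u' := by
  have hnn : ∀ u : List ι, 0 ≤ (u.map len).sum := fun u => List.sum_nonneg fun y hy => by
    obtain ⟨b, -, rfl⟩ := List.mem_map.1 hy
    exact (hlen b).le
  induction u with
  | nil =>
    intro u' x x' _ _ hsum _
    cases u' with
    | nil => exact .nil
    | cons b u' =>
      simp only [List.map_nil, List.sum_nil, List.map_cons, List.sum_cons] at hsum
      linarith [hlen b, hnn u']
  | cons a u ih =>
    intro u' x x' hu hu' hsum hagree
    cases u' with
    | nil =>
      simp only [List.map_nil, List.sum_nil, List.map_cons, List.sum_cons] at hsum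
      linarith [hlen a, hnn u]
    | cons b u' =>
      simp only [List.map_cons, List.sum_cons] at hsum hagree
      have ha : (x, a) ∈ S := hu (Set.mem_insert _ _)
      have hb : (x', b) ∈ S := hu' (Set.mem_insert _ _)
      have hab : len a = len b := by
        have h1 : IsTile X x' (x' + len a) := (hS.2 _ ha).transfer fun k hk hk' =>
          hagree k (by linarith) (by linarith [hnn u])
        linarith [h1.unique (hS.2 _ hb)]
      refine .cons (hr _ ha _ hb (neighbourhoodShape_eq_iff.2 fun h hh => ?_))
        (ih u' (x + len a) (x' + len b) (fun q hq => hu (Set.mem_insert_of_mem _ hq))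
          (fun q hq => hu' (Set.mem_insert_of_mem _ hq)) (by linarith) fun h h1 h2 => ?_)
      · have := abs_le.1 hh
        exact hagree h (by linarith) (by linarith [hnn u, hlen a])
      · rw [← hab, add_assoc, add_assoc]
        exact hagree _ (by linarith [hlen a]) (by linarith)

/-- Induction on `n`: a large shape around a tile determines the shapes around all tiles of its
image patch, and the induction hypothesis then determines their unlabelled `n`-fold patches. Labels
need not be determined by shapes here, so the two words are compared only up to this relation. -/
theorem exists_radius_iter {ι : Type} [Finite ι] {σ : SubstitutionRule ι} {T : Set (ℝ × ι)}
    {X X₂ : Set ℝ} {K : ℝ} (hX₂ : IsDelone X₂) (hT : IsLabelling σ.len X T)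
    (hS : IsLabelling σ.len X₂ (σ.apply T)) (hST : PatchesOccurIn (σ.apply T) T)
    (hder : DerivesShapes σ.factor K X X₂) (n : ℕ) :
    ∃ R : ℝ, ∀ p ∈ T, ∀ q ∈ T,
      neighbourhoodShape X R p.1 = neighbourhoodShape X R q.1 →
      (σ.iter n p.2).map σ.len = (σ.iter n q.2).map σ.len := by
  obtain ⟨B, hB⟩ := (Set.finite_range σ.len).bddAbove
  have hB' : ∀ a, σ.len a ≤ B := fun a => hB ⟨a, rfl⟩
  have hfac : 0 < σ.factor := by linarith [σ.one_lt_factor]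
  have hlen : ∀ p ∈ T, ∀ q ∈ T, neighbourhoodShape X B p.1 = neighbourhoodShape X B q.1 →
      σ.len p.2 = σ.len q.2 := by
    intro p hp q hq h
    have h1 : IsTile X q.1 (q.1 + σ.len p.2) := (hT.2 p hp).transfer fun k hk hk' =>
      neighbourhoodShape_eq_iff.1 h k (by rw [abs_of_nonneg hk]; linarith [hB' p.2])
    linarith [h1.unique (hT.2 q hq)]
  induction n with
  | zero =>
    refine ⟨B, fun p hp q hq h => ?_⟩
    simp [SubstitutionRule.iter, hlen p hp q hq h]
  | succ n ih =>
    obtain ⟨R, hR⟩ := ih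
    refine ⟨max B ((σ.factor * B + |R|) / σ.factor + K), fun p hp q hq h => ?_⟩
    have hpq := hlen p hp q hq (neighbourhoodShape_eq_mono (le_max_left _ _) h)
    have h2 := hder _ _ (hT.2 p hp).1 _ (hT.2 q hq).1
      (neighbourhoodShape_eq_mono (le_max_right _ _) h)
    rw [neighbourhoodShape_eq_iff] at h2
    rw [σ.iter_succ', σ.iter_succ']
    refine flatMap_map_eq_of_forall₂ (forall₂_of_same_shape (R := |R|) σ.len_pos hS
      (abs_nonneg R) ?_ (σ.rep p.2) (σ.rep q.2) (σ.factor * p.1) (σ.factor * q.1)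
      (fun s hs => ⟨p, hp, hs⟩) (fun s hs => ⟨q, hq, hs⟩) ?_ ?_)
    · intro s hs s' hs' hss
      -- The induction hypothesis concerns tiles of T, so each tile of the image is exchanged for
      -- one of T with the same label and R-shape.
      obtain ⟨t, ht, e, hts⟩ := exists_shape_of_patchesOccurIn σ.len_pos hX₂ hT hS hST R hs
      obtain ⟨t', ht', e', hts'⟩ := exists_shape_of_patchesOccurIn σ.len_pos hX₂ hT hS hST R hs'
      rw [← e, ← e']
      exact hR t ht t' ht' (by
        rw [hts, hts']
        exact neighbourhoodShape_eq_mono (le_abs_self R) hss)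
    · rw [σ.covers, σ.covers, hpq]
    · rw [σ.covers]
      intro k hk hk'
      have := mul_le_mul_of_nonneg_left (hB' p.2) hfac.le
      have h0 : 0 ≤ σ.factor * B := mul_nonneg hfac.le ((σ.len_pos p.2).le.trans (hB' _))
      exact h2 k (abs_le.2 ⟨by linarith, by linarith⟩)

/-- Each of the finitely many pairs of distinct prototiles is separated by the lengths in some
iterate; a common radius determines all these iterates. -/
theorem isLocal_of_reduced {ι : Type} [Finite ι] {σ : SubstitutionRule ι} {T : Set (ℝ × ι)}
    {X X₂ : Set ℝ} {K : ℝ} (hX₂ : IsDelone X₂) (hT : IsLabelling σ.len X T)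
    (hS : IsLabelling σ.len X₂ (σ.apply T)) (hST : PatchesOccurIn (σ.apply T) T)
    (hder : DerivesShapes σ.factor K X X₂) (hred : σ.Reduced) : IsLocal X T := by
  choose R hR using exists_radius_iter hX₂ hT hS hST hder
  have hsep : ∀ ab : ι × ι, ∃ n : ℕ,
      (σ.iter n ab.1).map σ.len = (σ.iter n ab.2).map σ.len → ab.1 = ab.2 := by
    intro ab
    by_contra! hcon
    exact (hcon 0).2 (hred _ _ fun n => (hcon n).1)
  choose N hN using hsep
  obtain ⟨B, hB⟩ := (Set.finite_range fun ab => R (N ab)).bddAbove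
  exact ⟨B, fun p hp q hq h => hN (p.2, q.2)
    (hR _ p hp q hq (neighbourhoodShape_eq_mono (hB ⟨(p.2, q.2), rfl⟩) h))⟩

/-! ### Cut-and-project sets with an interval window. -/

/-- Two real coordinates Y and U of a lattice, with an automorphism m that contracts the first
and expands the second. -/
structure IsCutProject {Z : Type*} [AddCommGroup Z] (Y U : Z →+ ℝ) (m : Z →+ Z)
    (lam mu : ℝ) : Prop where
  Y_inj : Function.Injective Y
  U_inj : Function.Injective U
  finite : ∀ A : ℝ, {z | |U z| ≤ A ∧ |Y z| ≤ A}.Finite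
  approx : ∀ ε > 0, ∃ C : ℝ, ∀ s t : ℝ, ∃ z, |U z - s| ≤ C ∧ |Y z - t| < ε
  surj : Function.Surjective m
  Y_map : ∀ z, Y (m z) = mu * Y z
  U_map : ∀ z, U (m z) = lam * U z

/-- The U-coordinates of the lattice points with Y-coordinate in Ω. -/
def projSet {Z : Type*} [AddCommGroup Z] (Y U : Z →+ ℝ) (Ω : Set ℝ) : Set ℝ :=
  {u | ∃ z, Y z ∈ Ω ∧ U z = u}

/-- The point y is not below e, and different from e unless the flag is true. -/
def AboveEnd (o : Bool) (e y : ℝ) : Prop := if o then e ≤ y else e < y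

theorem mem_window_iff {o : Bool} {c L y : ℝ} :
    y ∈ window o c L ↔ AboveEnd o c y ∧ ¬ AboveEnd o (c + L) y := by
  cases o <;> simp [window, AboveEnd]

theorem aboveEnd_add {o : Bool} {e y t : ℝ} : AboveEnd o (e + t) y ↔ AboveEnd o e (y - t) := by
  cases o <;> simp [AboveEnd, lt_sub_iff_add_lt, le_sub_iff_add_le]

theorem AboveEnd.add {o : Bool} {e y t : ℝ} (h : AboveEnd o e y) (ht : 0 ≤ t) :
    AboveEnd o e (y + t) := by
  cases o <;> simp only [AboveEnd, if_true, Bool.false_eq_true, if_false] at h ⊢ <;> linarith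

theorem aboveEnd_mul_pos {o : Bool} {e y t : ℝ} (ht : 0 < t) :
    AboveEnd o e (t * y) ↔ AboveEnd o (e / t) y := by
  cases o <;> simp [AboveEnd, div_le_iff₀ ht, div_lt_iff₀ ht, mul_comm]

theorem aboveEnd_mul_neg {o : Bool} {e y t : ℝ} (ht : t < 0) :
    AboveEnd (!o) e (t * y) ↔ ¬ AboveEnd o (e / t) y := by
  cases o <;> simp [AboveEnd, le_div_iff_of_neg ht, lt_div_iff_of_neg ht, mul_comm]

theorem window_subset_Icc (o : Bool) (c L : ℝ) : window o c L ⊆ Set.Icc c (c + L) := by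
  cases o
  · simpa [window] using Set.Ioc_subset_Icc_self
  · simpa [window] using Set.Ico_subset_Icc_self

theorem Ioo_subset_window (o : Bool) (c L : ℝ) : Set.Ioo c (c + L) ⊆ window o c L := by
  cases o
  · simpa [window] using Set.Ioo_subset_Ioc_self
  · simpa [window] using Set.Ioo_subset_Ico_self

namespace IsCutProject

variable {Z : Type*} [AddCommGroup Z] {Y U : Z →+ ℝ} {m : Z →+ Z} {lam mu : ℝ}

theorem finite_box (h : IsCutProject Y U m lam mu) (a b c d : ℝ) :
    {z | U z ∈ Set.Icc a b ∧ Y z ∈ Set.Icc c d}.Finite := by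
  refine (h.finite (|a| + |b| + |c| + |d|)).subset ?_
  rintro z ⟨⟨h1, h2⟩, h3, h4⟩
  have := neg_abs_le a
  have := le_abs_self b
  have := neg_abs_le c
  have := le_abs_self d
  have := abs_nonneg a
  have := abs_nonneg b
  have := abs_nonneg c
  have := abs_nonneg d
  constructor <;> rw [abs_le] <;> constructor <;> linarith

theorem isDelone (h : IsCutProject Y U m lam mu) (o : Bool) (c : ℝ) {L : ℝ} (hL : 0 < L) :
    IsDelone (projSet Y U (window o c L)) := by
  refine ⟨fun a b => ?_, ?_⟩
  · refine ((h.finite_box a b c (c + L)).image U).subset ?_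
    rintro _ ⟨⟨z, hz, rfl⟩, hab⟩
    exact ⟨z, ⟨hab, window_subset_Icc _ _ _ hz⟩, rfl⟩
  · obtain ⟨C, hC⟩ := h.approx (L / 2) (by linarith)
    refine ⟨2 * C + 1, fun r => ?_⟩
    obtain ⟨z, h1, h2⟩ := hC (r + C + 1) (c + L / 2)
    rw [abs_le] at h1
    rw [abs_lt] at h2
    exact ⟨U z, ⟨z, Ioo_subset_window _ _ _ ⟨by linarith, by linarith⟩, rfl⟩, by linarith,
      by linarith⟩

/-- Differences of lattice points over the window lie in a box of height `2 * L`, so only finitely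
many relative positions occur at bounded distance. -/
theorem hasFiniteComplexity (h : IsCutProject Y U m lam mu) (o : Bool) (c L : ℝ) :
    HasFiniteComplexity (projSet Y U (window o c L)) := by
  intro R
  refine ⟨_, (h.finite_box (-R) R (-L) L).image U, ?_⟩
  rintro _ ⟨z, hz, rfl⟩ k ⟨hk, z', hz', hzk⟩
  have h1 := window_subset_Icc _ _ _ hz
  have h2 := window_subset_Icc _ _ _ hz'
  have e : U (z' - z) = k := by rw [map_sub, hzk]; ring
  refine ⟨z' - z, ⟨?_, ?_⟩, e⟩
  · rw [e]
    exact abs_le.1 hk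
  · rw [map_sub]
    constructor <;> linarith [h1.1, h1.2, h2.1, h2.2]

theorem exists_gap (h : IsCutProject Y U m lam mu) (R e : ℝ) :
    ∃ η > 0, ∀ z, |U z| ≤ R → Y z ≠ e → η ≤ |Y z - e| := by
  have hfin : {z | (U z ∈ Set.Icc (-R) R ∧ Y z ∈ Set.Icc (e - 1) (e + 1)) ∧ Y z ≠ e}.Finite :=
    (h.finite_box (-R) R (e - 1) (e + 1)).subset fun z hz => hz.1
  rcases Set.eq_empty_or_nonempty
    {z | (U z ∈ Set.Icc (-R) R ∧ Y z ∈ Set.Icc (e - 1) (e + 1)) ∧ Y z ≠ e} with h0 | h0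
  · refine ⟨1, one_pos, fun z hz hze => ?_⟩
    by_contra! hcon
    have h1 := abs_lt.1 hcon
    have : z ∈ (∅ : Set Z) := h0 ▸ ⟨⟨abs_le.1 hz, by linarith, by linarith⟩, hze⟩
    exact this
  · obtain ⟨z₀, hz₀, hmin⟩ := Set.exists_min_image _ (fun z => |Y z - e|) hfin h0
    refine ⟨min 1 |Y z₀ - e|, lt_min one_pos (abs_pos.2 (sub_ne_zero.2 hz₀.2)),
      fun z hz hze => ?_⟩
    by_contra! hcon
    have h1 := abs_lt.1 (hcon.trans_le (min_le_left _ _))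
    have := hmin z ⟨⟨abs_le.1 hz, by linarith, by linarith⟩, hze⟩
    exact absurd (hcon.trans_le (min_le_right _ _)) (not_lt.2 this)

/-- Translate by a lattice vector whose Y-coordinate is close to `c₂ - c`, displaced slightly from
the closed towards the open end. Points on the closed end move inside. The displacement is below the
gaps at both ends, so no other membership changes and the flag `o₂` is irrelevant. -/
theorem shapesOccurIn (h : IsCutProject Y U m lam mu) (o o₂ : Bool) (c c₂ L : ℝ) :
    ShapesOccurIn (projSet Y U (window o c L)) (projSet Y U (window o₂ c₂ L)) := by
  intro R
  obtain ⟨η₁, h1, hg1⟩ := h.exists_gap R c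
  obtain ⟨η₂, h2, hg2⟩ := h.exists_gap R (c + L)
  have hη : 0 < min η₁ η₂ := lt_min h1 h2
  set η := min η₁ η₂
  have hη1 : η ≤ η₁ := min_le_left _ _
  have hη2 : η ≤ η₂ := min_le_right _ _
  obtain ⟨C, hC⟩ := h.approx (η / 2) (by linarith)
  obtain ⟨k, -, hk⟩ := hC 0 (c₂ - c + if o then η / 2 else -(η / 2))
  rw [abs_lt] at hk
  have key : ∀ z, |U z| ≤ R → (Y z ∈ window o c L ↔ Y z + Y k ∈ window o₂ c₂ L) := by
    intro z hz
    have g1 := hg1 z hz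
    have g2 := hg2 z hz
    simp only [ne_eq, ← lt_or_lt_iff_ne, le_abs'] at g1 g2
    cases o
    · simp only [Bool.false_eq_true, if_false] at hk
      constructor
      · intro hz
        simp only [window, Bool.false_eq_true, if_false] at hz
        refine Ioo_subset_window _ _ _ ⟨?_, by linarith [hz.2]⟩
        rcases g1 (Or.inr hz.1) with h | h <;> linarith [hz.1]
      · intro hz
        have hz := window_subset_Icc _ _ _ hz
        simp only [window, Bool.false_eq_true, if_false]
        refine ⟨by linarith [hz.1], ?_⟩
        by_contra! hcon
        rcases g2 (Or.inr hcon) with h | h <;> linarith [hz.2]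
    · simp only [if_true] at hk
      constructor
      · intro hz
        simp only [window, if_true] at hz
        refine Ioo_subset_window _ _ _ ⟨by linarith [hz.1], ?_⟩
        rcases g2 (Or.inl hz.2) with h | h <;> linarith [hz.2]
      · intro hz
        have hz := window_subset_Icc _ _ _ hz
        simp only [window, if_true]
        refine ⟨?_, by linarith [hz.2]⟩
        by_contra! hcon
        rcases g1 (Or.inl hcon) with h | h <;> linarith [hz.1]
  refine ⟨U k, fun u hu => ⟨?_, ?_⟩⟩
  · rintro ⟨z, hz, rfl⟩
    exact ⟨z + k, by rw [map_add]; exact (key z hu).1 hz, map_add _ _ _⟩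
  · rintro ⟨z, hz, hzu⟩
    have e : U (z - k) = u := by rw [map_sub, hzu]; ring
    refine ⟨z - k, (key _ (by rwa [e])).2 ?_, e⟩
    rwa [← map_add, sub_add_cancel]

theorem mem_projSet (h : IsCutProject Y U m lam mu) (Ω : Set ℝ) (z : Z) :
    U z ∈ projSet Y U Ω ↔ Y z ∈ Ω :=
  ⟨fun ⟨_, hz', e⟩ => h.U_inj e ▸ hz', fun hz => ⟨z, hz, rfl⟩⟩

end IsCutProject

/-! ### Transport of shapes and its obstruction at the window ends. -/

/-- The end point e of the target window is the image of an end point of the source window, up to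
a lattice translation. -/
def IsEndImage {Z : Type*} [AddCommGroup Z] (Y : Z →+ ℝ) (mu c L e : ℝ) : Prop :=
  (∃ k, Y k = e - mu * c) ∨ ∃ k, Y k = e - mu * (c + L)

namespace IsCutProject

variable {Z : Type*} [AddCommGroup Z] {Y U : Z →+ ℝ} {m : Z →+ Z} {lam mu : ℝ}

/-- Membership in the window separates into its two end comparisons: starting inside, an upward
displacement cannot cross the bottom, nor a downward one the top, so at most one comparison is
undecided. -/
theorem aboveEnd_congr {o : Bool} {c L A : ℝ} {z z' : Z}
    (hz : Y z ∈ window o c L) (hz' : Y z' ∈ window o c L)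
    (hA : ∀ k, |U k| ≤ A → (Y z + Y k ∈ window o c L ↔ Y z' + Y k ∈ window o c L))
    (k : Z) (hk : |U k| ≤ A) :
    (AboveEnd o c (Y z + Y k) ↔ AboveEnd o c (Y z' + Y k)) ∧
    (AboveEnd o (c + L) (Y z + Y k) ↔ AboveEnd o (c + L) (Y z' + Y k)) := by
  rw [mem_window_iff] at hz hz'
  have hAk := hA k hk
  rw [mem_window_iff, mem_window_iff] at hAk
  rcases le_total 0 (Y k) with h0 | h0
  · have h1 := hz.1.add h0
    have h2 := hz'.1.add h0
    tauto
  · have h1 : ¬ AboveEnd o (c + L) (Y z + Y k) := fun hcon => hz.2 (by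
      simpa using hcon.add (neg_nonneg.2 h0))
    have h2 : ¬ AboveEnd o (c + L) (Y z' + Y k) := fun hcon => hz'.2 (by
      simpa using hcon.add (neg_nonneg.2 h0))
    tauto

/-- Since `m` is surjective, `e / mu` is an end of the source window shifted by some `Y κ`.
Comparing with it at `k` means comparing with the end itself at `k - κ`, which costs an extra radius
`|U κ|`. -/
theorem exists_aboveEnd_congr (h : IsCutProject Y U m lam mu) (hmu : mu ≠ 0) {o : Bool}
    {c L e : ℝ} (he : IsEndImage Y mu c L e) :
    ∃ B : ℝ, ∀ A z z', Y z ∈ window o c L → Y z' ∈ window o c L →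
      (∀ k, |U k| ≤ A + B → (Y z + Y k ∈ window o c L ↔ Y z' + Y k ∈ window o c L)) →
      ∀ k, |U k| ≤ A →
      (AboveEnd o (e / mu) (Y z + Y k) ↔ AboveEnd o (e / mu) (Y z' + Y k)) := by
  have main : ∀ κ : Z, (e / mu = c + Y κ ∨ e / mu = c + L + Y κ) →
      ∀ A z z', Y z ∈ window o c L → Y z' ∈ window o c L →
      (∀ k, |U k| ≤ A + |U κ| → (Y z + Y k ∈ window o c L ↔ Y z' + Y k ∈ window o c L)) →
      ∀ k, |U k| ≤ A →
      (AboveEnd o (e / mu) (Y z + Y k) ↔ AboveEnd o (e / mu) (Y z' + Y k)) := by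
    intro κ hκ A z z' hz hz' hA k hk
    have h1 := aboveEnd_congr hz hz' hA (k - κ)
      (by rw [map_sub]; exact (abs_sub _ _).trans (by linarith))
    simp only [map_sub, ← add_sub_assoc] at h1
    rcases hκ with hκ | hκ <;> 
      rw [hκ, aboveEnd_add (t := Y κ), aboveEnd_add (t := Y κ)]
    · exact h1.1
    · exact h1.2
  rcases he with ⟨k, hk⟩ | ⟨k, hk⟩ <;> obtain ⟨κ, rfl⟩ := h.surj k <;> rw [h.Y_map] at hk <;>
    refine ⟨|U κ|, main κ ?_⟩
  · left
    field_simp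
    linarith
  · right
    field_simp
    linarith

/-- Every lattice point is some `m x`, and `mu * Y x` lies in the target window according to the
position of `Y x` relative to the target ends divided by `mu`. The source shapes see these
positions. Negative `mu` reverses the order and hence the closed side, as `ho` prescribes. -/
theorem derivesShapes (h : IsCutProject Y U m lam mu) (hlam : 0 < lam) {o o₂ : Bool}
    {c c₂ L : ℝ} (ho : (0 < mu ∧ o₂ = o) ∨ (mu < 0 ∧ o₂ = !o))
    (hbot : IsEndImage Y mu c L c₂) (htop : IsEndImage Y mu c L (c₂ + L)) :
    ∃ K, DerivesShapes lam K (projSet Y U (window o c L)) (projSet Y U (window o₂ c₂ L)) := by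
  have hmu : mu ≠ 0 := by
    rcases ho with ho | ho
    · exact ho.1.ne'
    · exact ho.1.ne
  obtain ⟨B₁, h1⟩ := h.exists_aboveEnd_congr hmu (o := o) hbot
  obtain ⟨B₂, h2⟩ := h.exists_aboveEnd_congr hmu (o := o) htop
  refine ⟨max B₁ B₂, ?_⟩
  rintro R _ ⟨z, hz, rfl⟩ _ ⟨z', hz', rfl⟩ hshape
  rw [neighbourhoodShape_eq_iff] at hshape ⊢
  have hA : ∀ k, |U k| ≤ R / lam + max B₁ B₂ →
      (Y z + Y k ∈ window o c L ↔ Y z' + Y k ∈ window o c L) := by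
    intro k hk
    have := hshape (U k) hk
    rwa [← map_add, ← map_add, h.mem_projSet, h.mem_projSet, map_add, map_add] at this
  have hA1 := h1 (R / lam) z z' hz hz' fun k hk =>
    hA k (hk.trans (add_le_add_right (le_max_left _ _) _))
  have hA2 := h2 (R / lam) z z' hz hz' fun k hk =>
    hA k (hk.trans (add_le_add_right (le_max_right _ _) _))
  have hwin : ∀ k, |U k| ≤ R / lam →
      (mu * (Y z + Y k) ∈ window o₂ c₂ L ↔ mu * (Y z' + Y k) ∈ window o₂ c₂ L) := by
    intro k hk
    rw [mem_window_iff, mem_window_iff]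
    rcases ho with ⟨hpos, rfl⟩ | ⟨hneg, rfl⟩
    · simp only [aboveEnd_mul_pos hpos, hA1 k hk, hA2 k hk]
    · simp only [aboveEnd_mul_neg hneg, hA1 k hk, hA2 k hk]
  have main : ∀ z z' : Z, (∀ k, |U k| ≤ R / lam →
      (mu * (Y z + Y k) ∈ window o₂ c₂ L → mu * (Y z' + Y k) ∈ window o₂ c₂ L)) →
      ∀ k, |k| ≤ R → lam * U z + k ∈ projSet Y U (window o₂ c₂ L) →
        lam * U z' + k ∈ projSet Y U (window o₂ c₂ L) := by
    rintro z z' hzz k hk ⟨y, hy, hyk⟩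
    obtain ⟨x, rfl⟩ := h.surj y
    rw [h.U_map] at hyk
    rw [h.Y_map] at hy
    have e : lam * U (x - z) = k := by rw [map_sub]; linarith
    have e' : |k| = lam * |U (x - z)| := by rw [← e, abs_mul, abs_of_pos hlam]
    have hx := hzz (x - z) (by rw [le_div_iff₀ hlam]; linarith)
      (by rwa [← map_add, add_sub_cancel])
    refine ⟨m (z' + (x - z)), ?_, ?_⟩
    · rwa [h.Y_map, map_add]
    · rw [h.U_map, map_add, mul_add, e]
  exact fun k hk => ⟨main z z' (fun k hk => (hwin k hk).1) k hk,
    main z' z (fun k hk => (hwin k hk).2) k hk⟩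

/-- The labels of a local rule change only at lattice translates of the end points of the
window, whence so do the patches of the image tiling. -/
theorem isEndImage_of_isLocal (h : IsCutProject Y U m lam mu) (hlam : 0 < lam) (hmu : mu ≠ 0)
    {o o₂ : Bool} {c c₂ L : ℝ} (hL : 0 < L) {ι : Type} [Finite ι] {σ : SubstitutionRule ι}
    {T : Set (ℝ × ι)} (hfac : σ.factor = lam)
    (hT : IsLabelling σ.len (projSet Y U (window o c L)) T)
    (hS : IsLabelling σ.len (projSet Y U (window o₂ c₂ L)) (σ.apply T))
    (hloc : IsLocal (projSet Y U (window o c L)) T) {e : ℝ} (he : e = c₂ ∨ e = c₂ + L) :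
    IsEndImage Y mu c L e := by
  by_contra hcon
  obtain ⟨R, hR⟩ := hloc
  obtain ⟨B, hB⟩ := (Set.finite_range σ.len).bddAbove
  have hB' : ∀ a, σ.len a ≤ B := fun a => hB ⟨a, rfl⟩
  -- every end point of the window keeps a distance to the relevant translates of e / mu
  have gap : ∃ η > 0, ∀ d, 0 ≤ U d → U d ≤ lam * B → ∀ k, |U k| ≤ |R| →
      η ≤ |mu * c - (e - Y d + mu * Y k)| ∧ η ≤ |mu * (c + L) - (e - Y d + mu * Y k)| := by
    -- Only vectors `d - m k` of bounded U-coordinate occur, and none has Y-coordinate `e - mu * c`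
    -- or `e - mu * (c + L)` since `e` is no end image; so the distance is uniform.
    obtain ⟨η₁, g1, hg1⟩ := h.exists_gap (lam * B + lam * |R|) (e - mu * c)
    obtain ⟨η₂, g2, hg2⟩ := h.exists_gap (lam * B + lam * |R|) (e - mu * (c + L))
    refine ⟨min η₁ η₂, lt_min g1 g2, fun d hd hd' k hk => ?_⟩
    have hU : |U (d - m k)| ≤ lam * B + lam * |R| := by
      rw [map_sub, h.U_map]
      refine (abs_sub _ _).trans (add_le_add (by rwa [abs_of_nonneg hd]) ?_)
      rw [abs_mul, abs_of_pos hlam]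
      exact mul_le_mul_of_nonneg_left hk hlam.le
    have e1 := hg1 _ hU fun he' => hcon (Or.inl ⟨_, he'⟩)
    have e2 := hg2 _ hU fun he' => hcon (Or.inr ⟨_, he'⟩)
    rw [map_sub, h.Y_map] at e1 e2
    refine ⟨(min_le_left _ _).trans (e1.trans_eq ?_), (min_le_right _ _).trans (e2.trans_eq ?_)⟩ <;>
      congr 1 <;> ring
  obtain ⟨η, hη, hgap⟩ := gap
  -- `θ ≤ η` keeps both points within the gap; `θ ≤ L` keeps the inner one short of the opposite
  -- end.
  obtain ⟨θ, hθ, hθη, hθL⟩ : ∃ θ, 0 < θ ∧ θ ≤ η ∧ θ ≤ L :=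
    ⟨min η L, lt_min hη hL, min_le_left _ _, min_le_right _ _⟩
  obtain ⟨C, hC⟩ := h.approx (θ / 4) (by linarith)
  obtain ⟨z, hz, hze⟩ : ∃ z, Y z ∈ window o₂ c₂ L ∧ |Y z - e| < θ := by
    rcases he with rfl | rfl
    · obtain ⟨z, -, hz⟩ := hC 0 (e + θ / 2)
      rw [abs_lt] at hz
      exact ⟨z, Ioo_subset_window _ _ _ ⟨by linarith, by linarith⟩, by
        rw [abs_lt]; constructor <;> linarith⟩
    · obtain ⟨z, -, hz⟩ := hC 0 (c₂ + L - θ / 2)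
      rw [abs_lt] at hz
      exact ⟨z, Ioo_subset_window _ _ _ ⟨by linarith, by linarith⟩, by
        rw [abs_lt]; constructor <;> linarith⟩
  obtain ⟨z', hz', hze'⟩ : ∃ z, Y z ∉ window o₂ c₂ L ∧ |Y z - e| < θ := by
    rcases he with rfl | rfl
    · obtain ⟨z, -, hz⟩ := hC 0 (e - θ / 2)
      rw [abs_lt] at hz
      refine ⟨z, fun hcon => ?_, by rw [abs_lt]; constructor <;> linarith⟩
      linarith [(window_subset_Icc _ _ _ hcon).1]
    · obtain ⟨z, -, hz⟩ := hC 0 (c₂ + L + θ / 2)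
      rw [abs_lt] at hz
      refine ⟨z, fun hcon => ?_, by rw [abs_lt]; constructor <;> linarith⟩
      linarith [(window_subset_Icc _ _ _ hcon).2]
  -- the tile whose patch contains the vertex z
  obtain ⟨b, ⟨⟨x, a⟩, hp, hb⟩, -⟩ := hS.1 (U z) ⟨z, hz, rfl⟩
  obtain ⟨y, hy, rfl⟩ := (hT.2 _ hp).1
  simp only at hb
  rw [hfac] at hb
  have hd := le_of_mem_placeWord σ.len_pos _ _ _ hb
  rw [σ.covers, hfac] at hd
  simp only at hd
  have hBa := mul_le_mul_of_nonneg_left (hB' a) hlam.le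
  -- This makes `m y' - m y = z' - z`: relative to the inflated `y'`, the point `z'` sits where `z`
  -- sits relative to the inflated `y`.
  obtain ⟨y', hy'⟩ := h.surj (z' - z + m y)
  have eY : Y z - mu * Y y = Y (z - m y) := by rw [map_sub, h.Y_map]
  have eU : U z - lam * U y = U (z - m y) := by rw [map_sub, h.U_map]
  have eY' : mu * Y y' = Y z' - Y (z - m y) := by
    rw [← h.Y_map, hy', map_add, map_sub, map_sub]; ring
  have eU' : lam * U y' = U z' - U (z - m y) := by
    rw [← h.U_map, hy', map_add, map_sub, map_sub]; ring
  have hg := hgap (z - m y) (by rw [← eU]; linarith) (by rw [← eU]; linarith)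
  -- y and y' are on the same side of each end point
  have side : ∀ (s f t r r' : ℝ), η ≤ |mu * s - (f + mu * t)| →
      |mu * r - f| < η → |mu * r' - f| < η → ((s ≤ r + t ↔ s ≤ r' + t) ∧ (s < r + t ↔ s < r' + t)) := by
    intro s f t r r' h1 h2 h3
    rw [abs_lt] at h2 h3
    rw [le_abs'] at h1
    have aux : mu * (r + t - s) = mu * r + mu * t - mu * s := by ring
    have aux' : mu * (r' + t - s) = mu * r' + mu * t - mu * s := by ring
    rcases h1 with h1 | h1
    · have p1 : 0 < mu * (r + t - s) := by linarith
      have p2 : 0 < mu * (r' + t - s) := by linarith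
      rcases lt_or_gt_of_ne hmu with hm | hm
      · have q1 := neg_of_mul_pos_right p1 hm.le
        have q2 := neg_of_mul_pos_right p2 hm.le
        constructor <;> constructor <;> intro <;> linarith
      · have q1 := (mul_pos_iff_of_pos_left hm).1 p1
        have q2 := (mul_pos_iff_of_pos_left hm).1 p2
        constructor <;> constructor <;> intro <;> linarith
    · have p1 : mu * (r + t - s) < 0 := by linarith
      have p2 : mu * (r' + t - s) < 0 := by linarith
      rcases lt_or_gt_of_ne hmu with hm | hm
      · have q1 := pos_of_mul_neg_right p1 hm.le
        have q2 := pos_of_mul_neg_right p2 hm.le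
        constructor <;> constructor <;> intro <;> linarith
      · have q1 := neg_of_mul_neg_right p1 hm.le
        have q2 := neg_of_mul_neg_right p2 hm.le
        constructor <;> constructor <;> intro <;> linarith
  have hsame : ∀ k, |U k| ≤ |R| → (Y y + Y k ∈ window o c L ↔ Y y' + Y k ∈ window o c L) := by
    intro k hk
    obtain ⟨g1, g2⟩ := hg k hk
    have n1 : |mu * Y y - (e - Y (z - m y))| < η := by
      rw [← eY, show mu * Y y - (e - (Y z - mu * Y y)) = Y z - e by ring]
      exact hze.trans_le hθη
    have n2 : |mu * Y y' - (e - Y (z - m y))| < η := by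
      rw [eY', show Y z' - Y (z - m y) - (e - Y (z - m y)) = Y z' - e by ring]
      exact hze'.trans_le hθη
    have s1 := side _ _ _ _ _ g1 n1 n2
    have s2 := side _ _ _ _ _ g2 n1 n2
    cases o <;> simp only [mem_window_iff, AboveEnd, if_true, Bool.false_eq_true, if_false, s1, s2]
  have hyw : Y y' ∈ window o c L := by
    simpa using (hsame 0 (by simp)).1 (by simpa using hy)
  obtain ⟨a', ha', -⟩ := hT.1 (U y') ⟨y', hyw, rfl⟩
  have haa : a = a' := by
    refine hR _ hp _ ha' (neighbourhoodShape_eq_iff.2 fun k hk => ?_)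
    have main : ∀ x x' : Z, (∀ k, |U k| ≤ |R| →
        (Y x + Y k ∈ window o c L → Y x' + Y k ∈ window o c L)) →
        U x + k ∈ projSet Y U (window o c L) → U x' + k ∈ projSet Y U (window o c L) := by
      rintro x x' hxx ⟨w, hw, hwk⟩
      have ek : U (w - x) = k := by rw [map_sub, hwk]; ring
      refine ⟨x' + (w - x), ?_, by rw [map_add, ek]⟩
      rw [map_add]
      exact hxx _ (by rw [ek]; exact hk.trans (le_abs_self R))
        (by rwa [← map_add, add_sub_cancel])
    exact ⟨main y y' fun k hk => (hsame k hk).1, main y' y fun k hk => (hsame k hk).2⟩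
  subst haa
  -- Equal labels have equal patches, so `z'` would be a vertex of the target although it lies
  -- outside the window.
  have hmem : (U z', b) ∈ σ.apply T := by
    refine ⟨_, ha', ?_⟩
    simp only
    rw [hfac, show lam * U y' = lam * U y + (U z' - U z) by rw [eU', ← eU]; ring,
      mem_placeWord_add]
    simpa using hb
  exact hz' ((h.mem_projSet _ _).1 (hS.2 _ hmem).1)

end IsCutProject

/-! ### The integer lattice and its eigencoordinates. -/

/-- The projection to Y on the integer lattice. -/
noncomputable def latY (v : Fin 2 → ℝ) : (Fin 2 → ℤ) →+ ℝ :=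
  AddMonoidHom.mk' (fun z => projY v (latticePoint z)) fun x y => by
    simp only [projY, latticePoint, Pi.add_apply, Int.cast_add]
    ring

/-- The projection to V on the integer lattice. -/
noncomputable def latU (v w : Fin 2 → ℝ) : (Fin 2 → ℤ) →+ ℝ :=
  AddMonoidHom.mk' (fun z => projV v w (latticePoint z)) fun x y => by
    simp only [projV, latticePoint, Pi.add_apply, Int.cast_add]
    ring

theorem mulVec_fin_two {R : Type*} [CommRing R] (M : Matrix (Fin 2) (Fin 2) ℤ)
    (x : Fin 2 → R) (i : Fin 2) :
    (M.map (Int.cast : ℤ → R) *ᵥ x) i = M i 0 * x 0 + M i 1 * x 1 := by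
  simp [Matrix.mulVec, dotProduct, Fin.sum_univ_two]

theorem latticePoint_mulVec (M : Matrix (Fin 2) (Fin 2) ℤ) (z : Fin 2 → ℤ) :
    latticePoint (M *ᵥ z) = M.map (Int.cast : ℤ → ℝ) *ᵥ latticePoint z := by
  ext i
  rw [mulVec_fin_two]
  simp [latticePoint, Matrix.mulVec, dotProduct, Fin.sum_univ_two]

theorem eq_zero_of_finite_range_pow_mul {r y : ℝ} (hr0 : r ≠ 0) (hr : |r| < 1)
    (h : (Set.range fun n : ℕ => r ^ n * y).Finite) : y = 0 := by
  by_contra hy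
  refine Set.infinite_range_of_injective (fun n k hnk => ?_) h
  have h1 := mul_right_cancel₀ hy hnk
  have h2 : |r| ^ n = |r| ^ k := by rw [← abs_pow, h1, abs_pow]
  exact pow_right_injective₀ (abs_pos.2 hr0) hr.ne h2

/-- The matrix has the eigenvalues lam and mu with the eigenvectors v and w; v is not vertical
and not parallel to w, and lam * mu = ±1 is the determinant. -/
structure IsEigenData (M : Matrix (Fin 2) (Fin 2) ℤ) (lam mu : ℝ) (v w : Fin 2 → ℝ) : Prop where
  one_lt : 1 < lam
  v_ne : v 0 ≠ 0
  indep : v 0 * w 1 - v 1 * w 0 ≠ 0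
  unit : lam * mu = 1 ∧ M.det = 1 ∨ lam * mu = -1 ∧ M.det = -1
  trace : lam + mu = M 0 0 + M 1 1
  det : lam * mu = M 0 0 * M 1 1 - M 0 1 * M 1 0
  v0 : M 0 0 * v 0 + M 0 1 * v 1 = lam * v 0
  v1 : M 1 0 * v 0 + M 1 1 * v 1 = lam * v 1
  w0 : M 0 0 * w 0 + M 0 1 * w 1 = mu * w 0
  w1 : M 1 0 * w 0 + M 1 1 * w 1 = mu * w 1

/-- A vertical `v` would make M triangular with `lam` a diagonal entry dividing the determinant,
hence `±1`, against `lam > 1`. Trace and determinant are checked after multiplication by the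
determinant of the two eigenvectors. -/
theorem isEigenData {M : Matrix (Fin 2) (Fin 2) ℤ} (hdet : IsUnit M.det)
    {lam mu : ℝ} (hlam : 1 < lam) (hmu : |mu| < 1)
    {v w : Fin 2 → ℝ} (hv : v ≠ 0) (hw : w ≠ 0)
    (hMv : M.map (Int.cast : ℤ → ℝ) *ᵥ v = lam • v)
    (hMw : M.map (Int.cast : ℤ → ℝ) *ᵥ w = mu • w) : IsEigenData M lam mu v w := by
  have v0 := congrFun hMv 0
  have v1 := congrFun hMv 1
  have w0 := congrFun hMw 0
  have w1 := congrFun hMw 1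
  simp only [mulVec_fin_two, Pi.smul_apply, smul_eq_mul] at v0 v1 w0 w1
  have hne : lam ≠ mu := fun h => by linarith [le_abs_self mu]
  have hv0 : v 0 ≠ 0 := by
    intro h0
    have h1 : v 1 ≠ 0 := fun h1 => hv (by ext i; fin_cases i <;> assumption)
    rw [h0, mul_zero, zero_add, mul_zero] at v0
    have hb : M 0 1 = 0 := by
      rcases mul_eq_zero.1 v0 with h | h
      · exact_mod_cast h
      · exact absurd h h1
    rw [h0, mul_zero, zero_add] at v1
    have hd : ((M 1 1 : ℤ) : ℝ) = lam := mul_right_cancel₀ h1 v1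
    rw [Matrix.det_fin_two, hb, zero_mul, sub_zero] at hdet
    rcases Int.isUnit_iff.1 (isUnit_of_mul_isUnit_right hdet) with h | h <;> rw [h] at hd <;>
      norm_num at hd <;> linarith
  have hD : v 0 * w 1 - v 1 * w 0 ≠ 0 := by
    intro hD
    have h0 : w 0 = 0 := by
      have : w 0 * (v 0 * (lam - mu)) = 0 := by
        linear_combination (-w 0) * v0 + v 0 * w0 - (M 0 1 : ℝ) * hD
      exact (mul_eq_zero.1 this).resolve_right (mul_ne_zero hv0 (sub_ne_zero.2 hne))
    have h1 : w 1 = 0 := by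
      rw [h0, mul_zero, sub_zero] at hD
      exact (mul_eq_zero.1 hD).resolve_left hv0
    exact hw (by ext i; fin_cases i <;> assumption)
  have htr : lam + mu = M 0 0 + M 1 1 := by
    refine mul_right_cancel₀ hD ?_
    linear_combination (-w 1) * v0 + w 0 * v1 + v 1 * w0 - v 0 * w1
  have hdt : lam * mu = M 0 0 * M 1 1 - M 0 1 * M 1 0 := by
    refine mul_right_cancel₀ hD ?_
    linear_combination (-mu * w 1) * v0 + mu * w 0 * v1 +
      ((M 1 0 : ℝ) * v 0 + (M 1 1 : ℝ) * v 1) * w0 - ((M 0 0 : ℝ) * v 0 + (M 0 1 : ℝ) * v 1) * w1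
  have hdt' : lam * mu = (M.det : ℝ) := by
    rw [hdt, Matrix.det_fin_two]
    push_cast
    rfl
  refine ⟨hlam, hv0, hD, ?_, htr, hdt, v0, v1, w0, w1⟩
  rcases Int.isUnit_iff.1 hdet with h | h
  · left
    rw [hdt', h]
    simp
  · right
    rw [hdt', h]
    simp

namespace IsEigenData

variable {M : Matrix (Fin 2) (Fin 2) ℤ} {lam mu : ℝ} {v w : Fin 2 → ℝ}

theorem mu_ne (h : IsEigenData M lam mu v w) : mu ≠ 0 := by
  rintro rfl
  rcases h.unit with h | h <;> norm_num at h

theorem projY_mulVec (h : IsEigenData M lam mu v w) (x : Fin 2 → ℝ) :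
    projY v (M.map (Int.cast : ℤ → ℝ) *ᵥ x) = mu * projY v x := by
  have hv := h.v_ne
  simp only [projY, mulVec_fin_two]
  field_simp
  linear_combination (x 0) * h.v1 - (x 1) * h.v0 + (v 1 * x 0 - v 0 * x 1) * h.trace

theorem projV_mulVec (h : IsEigenData M lam mu v w) (x : Fin 2 → ℝ) :
    projV v w (M.map (Int.cast : ℤ → ℝ) *ᵥ x) = lam * projV v w x := by
  have hD := h.indep
  simp only [projV, mulVec_fin_two]
  rw [← mul_div_assoc]
  congr 1
  linear_combination (x 1) * h.w0 - (x 0) * h.w1 + (x 1 * w 0 - x 0 * w 1) * h.trace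

/-- Finiteness holds because the two projections are linear coordinates of the plane. The remaining
points come from iterating M: a nonzero kernel vector of one projection would have infinitely many
images in a bounded box, and contraction along Y sharpens a rough approximation. -/
theorem isCutProject (h : IsEigenData M lam mu v w) (hmu : |mu| < 1) :
    IsCutProject (latY v) (latU v w) M.mulVecLin.toAddMonoidHom lam mu := by
  have hlam := h.one_lt
  have hlam0 : 0 < lam := by linarith
  have hm0 := h.mu_ne
  have hv := h.v_ne
  have hD := h.indep
  have Y_map : ∀ z, latY v (M *ᵥ z) = mu * latY v z := fun z => by
    change projY v (latticePoint (M *ᵥ z)) = _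
    rw [latticePoint_mulVec, h.projY_mulVec]
    rfl
  have U_map : ∀ z, latU v w (M *ᵥ z) = lam * latU v w z := fun z => by
    change projV v w (latticePoint (M *ᵥ z)) = _
    rw [latticePoint_mulVec, h.projV_mulVec]
    rfl
  have Y_iter : ∀ (n : ℕ) z, latY v (M.mulVec^[n] z) = mu ^ n * latY v z := by
    intro n z
    induction n with
    | zero => simp
    | succ n ih => rw [Function.iterate_succ_apply', Y_map, ih, pow_succ']; ring
  have U_iter : ∀ (n : ℕ) z, latU v w (M.mulVec^[n] z) = lam ^ n * latU v w z := by
    intro n z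
    induction n with
    | zero => simp
    | succ n ih => rw [Function.iterate_succ_apply', U_map, ih, pow_succ']; ring
  have hunit : IsUnit M.det := by
    rcases h.unit with h | h <;> rw [h.2] <;> decide
  have surj : Function.Surjective M.mulVec := fun z =>
    ⟨M⁻¹ *ᵥ z, by rw [Matrix.mulVec_mulVec, Matrix.mul_nonsing_inv _ hunit, Matrix.one_mulVec]⟩
  -- a lattice point in terms of its projections
  have coord : ∀ (z : Fin 2 → ℤ) (i : Fin 2), (z i : ℝ) =
      latU v w z * v i + latY v z * (v 0 * w i / (v 0 * w 1 - v 1 * w 0)) := by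
    intro z i
    change (z i : ℝ) = projV v w (latticePoint z) * v i + projY v (latticePoint z) * _
    simp only [projV, projY, latticePoint]
    obtain ⟨D, hDe⟩ : ∃ D, D = v 0 * w 1 - v 1 * w 0 := ⟨_, rfl⟩
    rw [← hDe] at hD ⊢
    field_simp
    rw [hDe]
    fin_cases i <;> simp only [Fin.zero_eta, Fin.mk_one] <;> ring
  have finite : ∀ A : ℝ, {z | |latU v w z| ≤ A ∧ |latY v z| ≤ A}.Finite := by
    intro A
    have : ∃ N : ℤ, ∀ z : Fin 2 → ℤ, |latU v w z| ≤ A → |latY v z| ≤ A → ∀ i, |z i| ≤ N := by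
      let B : Fin 2 → ℝ := fun i => A * |v i| + A * |v 0 * w i / (v 0 * w 1 - v 1 * w 0)|
      refine ⟨⌈max (B 0) (B 1)⌉, fun z h1 h2 i => ?_⟩
      have hi : |(z i : ℝ)| ≤ B i := by
        rw [coord z i]
        refine (abs_add_le _ _).trans ?_
        rw [abs_mul, abs_mul]
        exact add_le_add (mul_le_mul_of_nonneg_right h1 (abs_nonneg _))
          (mul_le_mul_of_nonneg_right h2 (abs_nonneg _))
      have hB : B i ≤ max (B 0) (B 1) := by
        fin_cases i
        · exact le_max_left _ _
        · exact le_max_right _ _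
      have := (hi.trans hB).trans (Int.le_ceil _)
      exact_mod_cast this
    obtain ⟨N, hN⟩ := this
    refine (Set.finite_Icc (fun _ : Fin 2 => -N) fun _ => N).subset ?_
    rintro z ⟨h1, h2⟩
    exact ⟨fun i => (abs_le.1 (hN z h1 h2 i)).1, fun i => (abs_le.1 (hN z h1 h2 i)).2⟩
  have joint : ∀ z, latU v w z = 0 → latY v z = 0 → z = 0 := by
    intro z h1 h2
    ext i
    have := coord z i
    rw [h1, h2, zero_mul, zero_mul, add_zero] at this
    exact_mod_cast this
  have Y_ker : ∀ z, latY v z = 0 → z = 0 := by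
    intro z hz
    refine joint z (eq_zero_of_finite_range_pow_mul (r := lam⁻¹) (inv_ne_zero hlam0.ne') ?_ ?_) hz
    · rw [abs_of_pos (inv_pos.2 hlam0)]
      exact inv_lt_one_of_one_lt₀ hlam
    · refine ((finite |latU v w z|).image (latU v w)).subset ?_
      rintro _ ⟨n, rfl⟩
      -- Pulling back by `M ^ n` shrinks U and keeps Y zero, so all preimages stay in one box.
      obtain ⟨k, rfl⟩ := surj.iterate n z
      rw [Y_iter] at hz
      have hk : latY v k = 0 := (mul_eq_zero.1 hz).resolve_left (pow_ne_zero n hm0)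
      refine ⟨k, ⟨?_, by rw [hk, abs_zero]; exact abs_nonneg _⟩, ?_⟩
      · rw [U_iter, abs_mul, abs_of_pos (pow_pos hlam0 n)]
        exact le_mul_of_one_le_left (abs_nonneg _) (one_le_pow₀ hlam.le)
      · simp only
        rw [U_iter, ← mul_assoc, ← mul_pow, inv_mul_cancel₀ hlam0.ne', one_pow, one_mul]
  have U_ker : ∀ z, latU v w z = 0 → z = 0 := by
    intro z hz
    refine joint z hz (eq_zero_of_finite_range_pow_mul hm0 hmu ?_)
    refine ((finite |latY v z|).image (latY v)).subset ?_
    rintro _ ⟨n, rfl⟩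
    refine ⟨M.mulVec^[n] z, ⟨by rw [U_iter, hz, mul_zero, abs_zero]; exact abs_nonneg _, ?_⟩,
      Y_iter n z⟩
    rw [Y_iter, abs_mul, abs_pow]
    exact mul_le_of_le_one_left (abs_nonneg _) (pow_le_one₀ (abs_nonneg _) hmu.le)
  have rough : ∃ C : ℝ, ∀ s t : ℝ, ∃ z, |latU v w z - s| ≤ C ∧ |latY v z - t| ≤ C := by
    obtain ⟨D, hDe⟩ : ∃ D, D = v 0 * w 1 - v 1 * w 0 := ⟨_, rfl⟩
    rw [← hDe] at hD
    let C₁ := |w 1 / D| + |w 0 / D|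
    let C₂ := 1 + |v 1 / v 0|
    refine ⟨C₁ + C₂, fun s t => ?_⟩
    obtain ⟨x, hx⟩ : ∃ x : Fin 2 → ℝ, ∀ i, x i = s * v i + t * (v 0 * w i / D) :=
      ⟨_, fun _ => rfl⟩
    have hxV : x 0 * w 1 - x 1 * w 0 = s * D := by
      rw [hx, hx, hDe]
      ring
    have hxY : x 1 * v 0 - x 0 * v 1 = t * v 0 := by
      rw [hx, hx]
      field_simp
      rw [hDe]
      ring
    have d : ∀ i, |(⌊x i⌋ : ℝ) - x i| ≤ 1 := fun i => by
      rw [abs_sub_comm, Int.self_sub_floor, abs_of_nonneg (Int.fract_nonneg _)]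
      exact (Int.fract_lt_one _).le
    have eU : latU v w (fun i => ⌊x i⌋) - s =
        w 1 / D * ((⌊x 0⌋ : ℝ) - x 0) + -(w 0 / D) * ((⌊x 1⌋ : ℝ) - x 1) := by
      change projV v w (latticePoint fun i => ⌊x i⌋) - s = _
      simp only [projV, latticePoint, ← hDe]
      field_simp
      linear_combination hxV
    have eY : latY v (fun i => ⌊x i⌋) - t =
        1 * ((⌊x 1⌋ : ℝ) - x 1) + -(v 1 / v 0) * ((⌊x 0⌋ : ℝ) - x 0) := by
      change projY v (latticePoint fun i => ⌊x i⌋) - t = _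
      simp only [projY, latticePoint]
      field_simp
      linear_combination hxY
    have est : ∀ a b p q : ℝ, |p| ≤ 1 → |q| ≤ 1 → |a * p + b * q| ≤ |a| + |b| := by
      intro a b p q hp hq
      refine (abs_add_le _ _).trans ?_
      rw [abs_mul, abs_mul]
      exact add_le_add (mul_le_of_le_one_right (abs_nonneg _) hp)
        (mul_le_of_le_one_right (abs_nonneg _) hq)
    have n1 : 0 ≤ C₁ := by positivity
    have n2 : 0 ≤ C₂ := by positivity
    refine ⟨fun i => ⌊x i⌋, ?_, ?_⟩
    · rw [eU]
      refine (est _ _ _ _ (d 0) (d 1)).trans ?_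
      rw [abs_neg]
      linarith
    · rw [eY]
      refine (est _ _ _ _ (d 1) (d 0)).trans ?_
      rw [abs_neg, abs_one]
      linarith
  refine ⟨(injective_iff_map_eq_zero _).2 Y_ker, (injective_iff_map_eq_zero _).2 U_ker, finite,
    fun ε hε => ?_, surj, Y_map, U_map⟩
  -- Approximating `(s / lam ^ n, t / mu ^ n)` with error `C` and applying `M ^ n` leaves a Y-error
  -- of at most `|mu| ^ n * C` and a bounded U-error `lam ^ n * C`.
  obtain ⟨C, hC⟩ := rough
  have hlim := (tendsto_pow_atTop_nhds_zero_of_lt_one (abs_nonneg mu) hmu).mul_const C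
  rw [zero_mul] at hlim
  obtain ⟨n, hn⟩ := (hlim.eventually_lt_const hε).exists
  refine ⟨lam ^ n * C, fun s t => ?_⟩
  obtain ⟨z, h1, h2⟩ := hC (s / lam ^ n) (t / mu ^ n)
  have hl : 0 < lam ^ n := pow_pos hlam0 n
  have hm : mu ^ n ≠ 0 := pow_ne_zero n hm0
  refine ⟨M.mulVec^[n] z, ?_, ?_⟩
  · rw [U_iter, show lam ^ n * latU v w z - s = lam ^ n * (latU v w z - s / lam ^ n) by
      field_simp, abs_mul, abs_of_pos hl]
    exact mul_le_mul_of_nonneg_left h1 hl.le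
  · rw [Y_iter, show mu ^ n * latY v z - t = mu ^ n * (latY v z - t / mu ^ n) by
      field_simp, abs_mul, abs_pow]
    exact (mul_le_mul_of_nonneg_left h2 (by positivity)).trans_lt hn

/-- The eigenvector equation gives `v` the slope `M 0 1 * (lam - M 0 0)` when `M 0 1 = ±1`, so Λ is
`ℤ + ℤ lam`; the characteristic equation makes this closed under products. -/
theorem latticeY_eq_adjoin (h : IsEigenData M lam mu v w) (hM : |M 0 1| = 1) :
    latticeY v = (Algebra.adjoin ℤ {lam} : Set ℝ) := by
  have hv := h.v_ne
  have hb : (M 0 1 : ℝ) * M 0 1 = 1 := by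
    rcases (abs_eq zero_le_one).1 hM with h | h <;> rw [h] <;> norm_num
  have hslope : v 1 / v 0 = M 0 1 * (lam - M 0 0) := by
    rw [div_eq_iff hv]
    linear_combination (-v 1) * hb + (M 0 1 : ℝ) * h.v0
  have hsq : lam * lam = (M 0 0 + M 1 1) * lam - (M 0 0 * M 1 1 - M 0 1 * M 1 0) := by
    linear_combination lam * h.trace - h.det
  have hmem : ∀ x, x ∈ latticeY v ↔ ∃ p q : ℤ, x = p + q * lam := by
    intro x
    constructor
    · rintro ⟨z, rfl⟩
      refine ⟨z 1 + M 0 1 * M 0 0 * z 0, -(M 0 1 * z 0), ?_⟩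
      simp only [projY, latticePoint, hslope]
      push_cast
      ring
    · rintro ⟨p, q, rfl⟩
      refine ⟨![-(M 0 1 * q), p + M 0 0 * q], ?_⟩
      simp only [projY, latticePoint, hslope, Matrix.cons_val_zero, Matrix.cons_val_one]
      push_cast
      linear_combination (q : ℝ) * (lam - M 0 0) * hb
  ext x
  rw [hmem]
  constructor
  · rintro ⟨p, q, rfl⟩
    refine add_mem ?_ (mul_mem ?_ (Algebra.subset_adjoin rfl))
    · exact (Algebra.adjoin ℤ {lam}).algebraMap_mem p
    · exact (Algebra.adjoin ℤ {lam}).algebraMap_mem q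
  · intro hx
    induction hx using Algebra.adjoin_induction with
    | mem x hx =>
      obtain rfl : x = lam := hx
      exact ⟨0, 1, by simp⟩
    | algebraMap r => exact ⟨r, 0, by simp⟩
    | add x y _ _ hx hy =>
      obtain ⟨p, q, rfl⟩ := hx
      obtain ⟨p', q', rfl⟩ := hy
      exact ⟨p + p', q + q', by push_cast; ring⟩
    | mul x y _ _ hx hy =>
      obtain ⟨p, q, rfl⟩ := hx
      obtain ⟨p', q', rfl⟩ := hy
      refine ⟨p * p' - q * q' * (M 0 0 * M 1 1 - M 0 1 * M 1 0),
        p * q' + q * p' + q * q' * (M 0 0 + M 1 1), ?_⟩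
      push_cast
      linear_combination (q : ℝ) * q' * hsq

end IsEigenData

/-! ### Arithmetic of the window ends. -/

theorem sSup_window (o : Bool) (c : ℝ) {L : ℝ} (hL : 0 < L) : sSup (window o c L) = c + L := by
  cases o
  · simpa [window] using csSup_Ioc (lt_add_of_pos_right c hL)
  · simpa [window] using csSup_Ico (lt_add_of_pos_right c hL)

theorem sInf_window (o : Bool) (c : ℝ) {L : ℝ} (hL : 0 < L) : sInf (window o c L) = c := by
  cases o
  · simpa [window] using csInf_Ioc (lt_add_of_pos_right c hL)
  · simpa [window] using csInf_Ico (lt_add_of_pos_right c hL)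

theorem ends_le_of_window_subset {o o' : Bool} {c c' L L' : ℝ} (hL : 0 < L) (hL' : 0 < L')
    (h : window o c L ⊆ window o' c' L') : c' ≤ c ∧ c + L ≤ c' + L' := by
  have hne : (window o c L).Nonempty :=
    ⟨c + L / 2, Ioo_subset_window _ _ _ ⟨by linarith, by linarith⟩⟩
  constructor
  · rw [← sInf_window o' c' hL', ← sInf_window o c hL]
    exact csInf_le_csInf (bddBelow_Icc.mono (window_subset_Icc _ _ _)) hne h
  · rw [← sSup_window o' c' hL', ← sSup_window o c hL]
    exact csSup_le_csSup (bddAbove_Icc.mono (window_subset_Icc _ _ _)) hne h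

theorem image_mul_window_pos (o : Bool) (c L : ℝ) {t : ℝ} (ht : 0 < t) :
    (fun y => t * y) '' window o c L = window o (t * c) (t * L) := by
  cases o
  · simp [window, Set.image_mul_left_Ioc ht, mul_add]
  · simp [window, Set.image_mul_left_Ico ht, mul_add]

theorem image_mul_window_neg (o : Bool) (c L : ℝ) {t : ℝ} (ht : t < 0) :
    (fun y => t * y) '' window o c L = window (!o) (t * (c + L)) (-t * L) := by
  ext y
  have e : t * (c + L) + -t * L = t * c := by ring
  rw [mem_window_iff, e]
  have hy : ∀ x, (fun y => t * y) x = y ↔ x = y / t := fun x => by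
    rw [eq_div_iff ht.ne, mul_comm]
  have hy' : y = t * (y / t) := by rw [mul_comm, div_mul_cancel₀ _ ht.ne]
  simp only [Set.mem_image, hy, exists_eq_right, mem_window_iff]
  conv_rhs => rw [hy']
  rw [aboveEnd_mul_neg ht, aboveEnd_mul_neg ht, mul_div_cancel_left₀ _ ht.ne,
    mul_div_cancel_left₀ _ ht.ne]
  tauto

theorem tilingVertices_window_eq {v : Fin 2 → ℝ} {c L : ℝ} (h : Nonsingular v c L)
    (w : Fin 2 → ℝ) (o o' : Bool) :
    tilingVertices v w (window o c L) = tilingVertices v w (window o' c L) := by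
  have key : ∀ (z : Fin 2 → ℤ) (b b' : Bool), projY v (latticePoint z) ∈ window b c L →
      projY v (latticePoint z) ∈ window b' c L := by
    intro z b b' hz
    have hm := window_subset_Icc _ _ _ hz
    refine Ioo_subset_window _ _ _ ⟨hm.1.lt_of_ne ?_, hm.2.lt_of_ne ?_⟩
    · exact fun e => h.1 ⟨z, e.symm⟩
    · exact fun e => h.2 ⟨z, e⟩
  ext u
  exact exists_congr fun z => and_congr_left' ⟨key z _ _, key z _ _⟩

theorem cast_mulVec (M : Matrix (Fin 2) (Fin 2) ℤ) (q : Fin 2 → ℚ) :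
    (fun i => (((M.map (Int.cast : ℤ → ℚ) *ᵥ q) i : ℚ) : ℝ)) =
      M.map (Int.cast : ℤ → ℝ) *ᵥ fun i => (q i : ℝ) := by
  ext i
  rw [mulVec_fin_two, mulVec_fin_two]
  push_cast
  rfl

theorem neg_mem_latticeY {v : Fin 2 → ℝ} {x : ℝ} : -x ∈ latticeY v ↔ x ∈ latticeY v :=
  neg_mem_iff (H := (latY v).range)

theorem add_mem_latticeY {v : Fin 2 → ℝ} {x y : ℝ} (hx : x ∈ latticeY v)
    (hy : y ∈ latticeY v) : x + y ∈ latticeY v :=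
  add_mem (S := AddSubgroup ℝ) (s := (latY v).range) hx hy

theorem sub_mem_latticeY {v : Fin 2 → ℝ} {x y : ℝ} (hx : x ∈ latticeY v)
    (hy : y ∈ latticeY v) : x - y ∈ latticeY v :=
  sub_eq_add_neg x y ▸ add_mem_latticeY hx (neg_mem_latticeY.2 hy)

namespace IsEigenData

variable {M : Matrix (Fin 2) (Fin 2) ℤ} {lam mu : ℝ} {v w : Fin 2 → ℝ}

theorem subwindow_eq (h : IsEigenData M lam mu v w) (Ω : Set ℝ) :
    subwindow M v Ω = (fun y => mu * y) '' Ω := by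
  refine Set.image_congr fun y _ => ?_
  rw [h.projY_mulVec]
  simp [projY]

/-- M permutes the integer lattice and acts on Y as multiplication by `mu`. -/
theorem mul_mem_latticeY (h : IsEigenData M lam mu v w) (hmu : |mu| < 1) {x : ℝ} :
    mu * x ∈ latticeY v ↔ x ∈ latticeY v := by
  have hc := h.isCutProject hmu
  constructor
  · rintro ⟨z, hz⟩
    obtain ⟨k, rfl⟩ := hc.surj z
    refine ⟨k, mul_left_cancel₀ h.mu_ne ?_⟩
    rw [← hz]
    exact (hc.Y_map k).symm
  · rintro ⟨z, rfl⟩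
    exact ⟨M *ᵥ z, hc.Y_map z⟩

theorem mu_sign (h : IsEigenData M lam mu v w) :
    (0 < mu ∧ lam * mu = 1 ∧ M.det = 1) ∨ (mu < 0 ∧ lam * mu = -1 ∧ M.det = -1) := by
  have h0 : 0 < lam := by linarith [h.one_lt]
  rcases h.unit with h1 | h1
  · exact Or.inl ⟨(mul_pos_iff_of_pos_left h0).1 (by rw [h1.1]; exact one_pos), h1⟩
  · exact Or.inr ⟨by nlinarith, h1⟩

/-- Both end points of the target window are images of end points of the source window up to
lattice translations if and only if the length condition holds. -/
theorem isEndImage_iff_lengthCondition (h : IsEigenData M lam mu v w) (hmu : |mu| < 1)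
    {L c c₂ : ℝ} (hL : 0 < L) {o o₂ : Bool}
    (hsub : subwindow M v (window o c L) ⊆ window o₂ c₂ L) :
    (IsEndImage (latY v) mu c L c₂ ∧ IsEndImage (latY v) mu c L (c₂ + L)) ↔
      LengthCondition v lam L
        (topDist (subwindow M v (window o c L)) (window o₂ c₂ L))
        (bottomDist (subwindow M v (window o c L)) (window o₂ c₂ L)) := by
  have hmul : ∀ {x}, mu * x ∈ latticeY v ↔ x ∈ latticeY v := h.mul_mem_latticeY hmu
  change ((c₂ - mu * c ∈ latticeY v ∨ c₂ - mu * (c + L) ∈ latticeY v) ∧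
    (c₂ + L - mu * c ∈ latticeY v ∨ c₂ + L - mu * (c + L) ∈ latticeY v)) ↔ _
  -- If both target ends come from the same source end, their difference `L` lies in Λ, hence so
  -- does `mu * L`, and one of them may be matched with the other source end. Two matchings remain:
  -- bottom to bottom, or bottom to top.
  have mid : ((c₂ - mu * c ∈ latticeY v ∨ c₂ - mu * (c + L) ∈ latticeY v) ∧
    (c₂ + L - mu * c ∈ latticeY v ∨ c₂ + L - mu * (c + L) ∈ latticeY v)) ↔
    (c₂ - mu * c ∈ latticeY v ∧ c₂ + L - mu * (c + L) ∈ latticeY v) ∨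
    (c₂ - mu * (c + L) ∈ latticeY v ∧ c₂ + L - mu * c ∈ latticeY v) := by
    constructor
    · rintro ⟨h1 | h1, h2 | h2⟩
      · have hLm : L ∈ latticeY v := by convert sub_mem_latticeY h2 h1 using 1; ring
        refine Or.inl ⟨h1, ?_⟩
        convert sub_mem_latticeY h2 (hmul.2 hLm) using 1
        ring
      · exact Or.inl ⟨h1, h2⟩
      · exact Or.inr ⟨h1, h2⟩
      · have hLm : L ∈ latticeY v := by convert sub_mem_latticeY h2 h1 using 1; ring
        refine Or.inl ⟨?_, h2⟩
        convert add_mem_latticeY h1 (hmul.2 hLm) using 1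
        ring
    · rintro (⟨h1, h2⟩ | ⟨h1, h2⟩)
      · exact ⟨Or.inl h1, Or.inr h2⟩
      · exact ⟨Or.inr h1, Or.inl h2⟩
  rw [mid]
  rw [h.subwindow_eq] at hsub ⊢
  rcases h.mu_sign with ⟨hpos, hunit, -⟩ | ⟨hneg, hunit, -⟩
  · rw [image_mul_window_pos o c L hpos] at hsub ⊢
    have hl := mul_pos hpos hL
    obtain ⟨hb, ht⟩ := ends_le_of_window_subset hl hL hsub
    rw [topDist, bottomDist, sSup_window _ _ hl, sSup_window _ _ hL, sInf_window _ _ hl,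
      sInf_window _ _ hL, abs_of_nonpos (by linarith), abs_of_nonneg (by linarith)]
    have e1 : -(mu * c + mu * L - (c₂ + L)) = c₂ + L - mu * (c + L) := by ring
    have e2 : mu * c - c₂ = -(c₂ - mu * c) := by ring
    -- Multiplying the conditions by `mu`, which does not affect membership in Λ, turns them into
    -- combinations of end differences by `lam * mu = 1`.
    have e3 : mu * (lam * (c₂ + L - mu * (c + L)) + L) = c₂ + L - mu * c := by
      linear_combination (c₂ + L - mu * (c + L)) * hunit
    have e4 : mu * (lam * -(c₂ - mu * c) + L) = -(c₂ - mu * (c + L)) := by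
      linear_combination (-(c₂ - mu * c)) * hunit
    have e5 : mu * ((1 - lam) * L) = c₂ - mu * c - (c₂ + L - mu * (c + L)) := by
      linear_combination (-L) * hunit
    have e6 : mu * ((-1 - lam) * L) = c₂ - mu * (c + L) - (c₂ + L - mu * c) := by
      linear_combination (-L) * hunit
    unfold LengthCondition
    rw [e1, e2, ← hmul (x := (1 - lam) * L), ← hmul (x := (-1 - lam) * L),
      ← hmul (x := lam * _ + L), ← hmul (x := lam * -_ + L), e3, e4, e5, e6, neg_mem_latticeY,
      neg_mem_latticeY]
    constructor
    · rintro (⟨h1, h2⟩ | ⟨h1, h2⟩)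
      · exact Or.inl ⟨sub_mem_latticeY h1 h2, h2, h1⟩
      · exact Or.inr ⟨sub_mem_latticeY h1 h2, h2, h1⟩
    · rintro (⟨-, h1, h2⟩ | ⟨-, h1, h2⟩)
      · exact Or.inl ⟨h2, h1⟩
      · exact Or.inr ⟨h2, h1⟩
  -- For negative `mu` the subwindow is reversed, so the two matchings exchange their roles in the
  -- length condition.
  · rw [image_mul_window_neg o c L hneg] at hsub ⊢
    have hl := mul_pos (neg_pos.2 hneg) hL
    obtain ⟨hb, ht⟩ := ends_le_of_window_subset hl hL hsub
    rw [topDist, bottomDist, sSup_window _ _ hl, sSup_window _ _ hL, sInf_window _ _ hl,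
      sInf_window _ _ hL, abs_of_nonpos (by linarith), abs_of_nonneg (by linarith)]
    have e1 : -(mu * (c + L) + -mu * L - (c₂ + L)) = c₂ + L - mu * c := by ring
    have e2 : mu * (c + L) - c₂ = -(c₂ - mu * (c + L)) := by ring
    have e3 : mu * (lam * (c₂ + L - mu * c) + L) = -(c₂ + L - mu * (c + L)) := by
      linear_combination (c₂ + L - mu * c) * hunit
    have e4 : mu * (lam * -(c₂ - mu * (c + L)) + L) = c₂ - mu * c := by
      linear_combination (-(c₂ - mu * (c + L))) * hunit
    have e5 : mu * ((1 - lam) * L) = c₂ + L - mu * c - (c₂ - mu * (c + L)) := by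
      linear_combination (-L) * hunit
    have e6 : mu * ((-1 - lam) * L) = c₂ + L - mu * (c + L) - (c₂ - mu * c) := by
      linear_combination (-L) * hunit
    unfold LengthCondition
    rw [e1, e2, ← hmul (x := (1 - lam) * L), ← hmul (x := (-1 - lam) * L),
      ← hmul (x := lam * _ + L), ← hmul (x := lam * -_ + L), e3, e4, e5, e6, neg_mem_latticeY,
      neg_mem_latticeY]
    constructor
    · rintro (⟨h1, h2⟩ | ⟨h1, h2⟩)
      · exact Or.inr ⟨sub_mem_latticeY h2 h1, h2, h1⟩
      · exact Or.inl ⟨sub_mem_latticeY h2 h1, h2, h1⟩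
    · rintro (⟨-, h1, h2⟩ | ⟨-, h1, h2⟩)
      · exact Or.inr ⟨h2, h1⟩
      · exact Or.inl ⟨h2, h1⟩

end IsEigenData

theorem IsLatticeVector.add {x y : Fin 2 → ℚ} (hx : IsLatticeVector x)
    (hy : IsLatticeVector y) : IsLatticeVector (x + y) := by
  obtain ⟨a, ha⟩ := hx
  obtain ⟨b, hb⟩ := hy
  exact ⟨a + b, fun i => by simp [ha, hb]⟩

theorem IsLatticeVector.neg {x : Fin 2 → ℚ} (hx : IsLatticeVector x) :
    IsLatticeVector (-x) := by
  obtain ⟨a, ha⟩ := hx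
  exact ⟨-a, fun i => by simp [ha]⟩

namespace IsEigenData

variable {M : Matrix (Fin 2) (Fin 2) ℤ} {lam mu : ℝ} {v w : Fin 2 → ℝ}

/-- The projection to Y is injective on integer vectors, hence on rational ones after clearing
denominators. -/
theorem isLatticeVector_iff (h : IsEigenData M lam mu v w) (hmu : |mu| < 1) (q : Fin 2 → ℚ) :
    IsLatticeVector q ↔ projY v (fun i => (q i : ℝ)) ∈ latticeY v := by
  have hc := h.isCutProject hmu
  constructor
  · rintro ⟨z, hz⟩
    refine ⟨z, ?_⟩
    congr 1
    ext i
    simp [latticePoint, hz]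
  · rintro ⟨z, hz⟩
    refine ⟨z, ?_⟩
    let N : ℤ := (q 0).den * (q 1).den
    have hN : (N : ℝ) ≠ 0 := by
      simp only [N]
      push_cast
      exact mul_ne_zero (Nat.cast_ne_zero.2 (q 0).den_nz) (Nat.cast_ne_zero.2 (q 1).den_nz)
    have q0 : (q 0 : ℝ) * (q 0).den = (q 0).num := by exact_mod_cast Rat.mul_den_eq_num (q 0)
    have q1 : (q 1 : ℝ) * (q 1).den = (q 1).num := by exact_mod_cast Rat.mul_den_eq_num (q 1)
    let y : Fin 2 → ℤ := ![(q 0).num * (q 1).den, (q 1).num * (q 0).den]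
    have hy : ∀ i, (y i : ℝ) = N * q i := by
      intro i
      fin_cases i
      · simp only [y, N, Fin.zero_eta, Matrix.cons_val_zero]
        push_cast
        rw [← q0]
        ring
      · simp only [y, N, Fin.mk_one, Matrix.cons_val_one]
        push_cast
        rw [← q1]
        ring
    have e : y = N • z := by
      apply hc.Y_inj
      rw [map_zsmul, zsmul_eq_mul]
      change projY v (latticePoint y) = N * projY v (latticePoint z)
      rw [hz]
      simp only [projY, latticePoint, hy]
      ring
    intro i
    have hi := hy i
    rw [e] at hi
    simp only [Pi.smul_apply, smul_eq_mul] at hi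
    push_cast at hi
    have := mul_left_cancel₀ hN hi
    exact_mod_cast this.symm

theorem isLatticeVector_mulVec (h : IsEigenData M lam mu v w) (hmu : |mu| < 1) (q : Fin 2 → ℚ) :
    IsLatticeVector (M.map (Int.cast : ℤ → ℚ) *ᵥ q) ↔ IsLatticeVector q := by
  rw [h.isLatticeVector_iff hmu, h.isLatticeVector_iff hmu, cast_mulVec, h.projY_mulVec,
    h.mul_mem_latticeY hmu]

/-- The end differences are the projections of `-s`, `-s - M l`, `l - s` and `l - s - M l`. Using
one source end twice puts `l` in the lattice; the straight and the crossed matching give `l - M l`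
and `l + M l`. -/
theorem isEndImage_iff_latticeCondition (h : IsEigenData M lam mu v w) (hmu : |mu| < 1)
    {L c c₂ : ℝ} {l s : Fin 2 → ℚ} (hl : projY v (fun i => (l i : ℝ)) = L)
    (hs : projY v (fun i => (s i : ℝ)) =
      projY v (M.map (Int.cast : ℤ → ℝ) *ᵥ ![0, c]) - c₂) :
    (IsEndImage (latY v) mu c L c₂ ∧ IsEndImage (latY v) mu c L (c₂ + L)) ↔
      LatticeCondition M l s := by
  set Ml := M.map (Int.cast : ℤ → ℚ) *ᵥ l with hMl
  have eM : projY v (fun i => (Ml i : ℝ)) = mu * L := by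
    rw [← hl, hMl, cast_mulVec, h.projY_mulVec]
  rw [h.projY_mulVec, show projY v ![0, c] = c by simp [projY]] at hs
  have hadd : ∀ x y : Fin 2 → ℚ, projY v (fun i => ((x + y) i : ℝ)) =
      projY v (fun i => (x i : ℝ)) + projY v (fun i => (y i : ℝ)) := by
    intro x y
    simp only [projY, Pi.add_apply, Rat.cast_add]
    ring
  have hneg : ∀ x : Fin 2 → ℚ, projY v (fun i => ((-x) i : ℝ)) =
      -projY v (fun i => (x i : ℝ)) := by
    intro x
    simp only [projY, Pi.neg_apply, Rat.cast_neg]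
    ring
  have p1 : (∃ k, latY v k = c₂ - mu * c) ↔ IsLatticeVector (-s) := by
    rw [h.isLatticeVector_iff hmu, hneg, hs, neg_sub]
    rfl
  have p2 : (∃ k, latY v k = c₂ - mu * (c + L)) ↔ IsLatticeVector (-s + -Ml) := by
    rw [h.isLatticeVector_iff hmu, hadd, hneg, hneg, hs, eM,
      show -(mu * c - c₂) + -(mu * L) = c₂ - mu * (c + L) by ring]
    rfl
  have p3 : (∃ k, latY v k = c₂ + L - mu * c) ↔ IsLatticeVector (l + -s) := by
    rw [h.isLatticeVector_iff hmu, hadd, hneg, hs, hl,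
      show L + -(mu * c - c₂) = c₂ + L - mu * c by ring]
    rfl
  have p4 : (∃ k, latY v k = c₂ + L - mu * (c + L)) ↔ IsLatticeVector (l + -s + -Ml) := by
    rw [h.isLatticeVector_iff hmu, hadd, hadd, hneg, hneg, hs, hl, eM,
      show L + -(mu * c - c₂) + -(mu * L) = c₂ + L - mu * (c + L) by ring]
    rfl
  unfold IsEndImage LatticeCondition
  rw [p1, p2, p3, p4, ← hMl]
  constructor
  · rintro ⟨h1 | h1, h2 | h2⟩
    · left
      exact ⟨by convert h2.add h1.neg using 1; abel, by convert h1.neg using 1; abel⟩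
    · right; left
      exact ⟨by convert h2.add h1.neg using 1; abel, by convert h1.neg using 1; abel⟩
    · right; right
      exact ⟨by convert h2.add h1.neg using 1; abel, by convert h2.neg using 1; abel⟩
    · left
      have hll : IsLatticeVector l := by convert h2.add h1.neg using 1; abel
      refine ⟨hll, ?_⟩
      convert h1.neg.add ((h.isLatticeVector_mulVec hmu l).2 hll).neg using 1
      rw [← hMl]
      abel
  · rintro (⟨h1, h2⟩ | ⟨h1, h2⟩ | ⟨h1, h2⟩)
    · exact ⟨Or.inl h2.neg, Or.inl (h1.add h2.neg)⟩
    · exact ⟨Or.inl h2.neg, Or.inr (by convert h1.add h2.neg using 1; abel)⟩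
    · exact ⟨Or.inr (by convert h2.neg.add h1.neg using 1; abel),
        Or.inl (by convert h2.neg using 1; abel)⟩

/-- The sign of `mu` is that of the determinant, so it decides whether closed sides must agree or
differ. A nonsingular window may have its flag changed to suit, because no lattice point projects to
its ends. -/
theorem exists_derivesShapes (h : IsEigenData M lam mu v w) (hmu : |mu| < 1)
    {L c c₂ : ℝ} {o o₂ : Bool}
    (ho : (o₂ = if M.det = 1 then o else !o) ∨ Nonsingular v c L ∨ Nonsingular v c₂ L)
    (hE : IsEndImage (latY v) mu c L c₂ ∧ IsEndImage (latY v) mu c L (c₂ + L)) :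
    ∃ K, DerivesShapes lam K (tilingVertices v w (window o c L))
      (tilingVertices v w (window o₂ c₂ L)) := by
  have hlam0 : 0 < lam := by linarith [h.one_lt]
  have key : ∀ b b₂ : Bool, (b₂ = if M.det = 1 then b else !b) →
      ∃ K, DerivesShapes lam K (tilingVertices v w (window b c L))
        (tilingVertices v w (window b₂ c₂ L)) := by
    intro b b₂ hb
    refine (h.isCutProject hmu).derivesShapes hlam0 ?_ hE.1 hE.2
    rcases h.mu_sign with ⟨hs, -, hd⟩ | ⟨hs, -, hd⟩
    · exact Or.inl ⟨hs, by simpa [hd] using hb⟩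
    · exact Or.inr ⟨hs, by simpa [hd] using hb⟩
  rcases ho with ho | ho | ho
  · exact key o o₂ ho
  · rw [tilingVertices_window_eq ho w o (if M.det = 1 then o₂ else !o₂)]
    exact key _ _ (by split_ifs <;> simp)
  · rw [tilingVertices_window_eq ho w o₂ (if M.det = 1 then o else !o)]
    exact key _ _ rfl

end IsEigenData

theorem mainTheorem4 (M : Matrix (Fin 2) (Fin 2) ℤ) (hdet : IsUnit M.det)
    (hprim : ∃ n : ℕ, ∀ i j, (M ^ n) i j ≠ 0)
    (lam mu : ℝ) (hlam : 1 < lam) (hmu : |mu| < 1)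
    (v w : Fin 2 → ℝ) (hv : v ≠ 0) (hw : w ≠ 0)
    (hMv : M.map (Int.cast : ℤ → ℝ) *ᵥ v = lam • v)
    (hMw : M.map (Int.cast : ℤ → ℝ) *ᵥ w = mu • w)
    (L c c₂ : ℝ) (hL : 0 < L) (o o₂ : Bool)
    (ho : (o₂ = if M.det = 1 then o else !o) ∨ Nonsingular v c L ∨ Nonsingular v c₂ L)
    (hsub : subwindow M v (window o c L) ⊆ window o₂ c₂ L) :
    (AdmitsLocalRule v w lam (window o c L) (window o₂ c₂ L) ↔
      LengthCondition v lam L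
        (topDist (subwindow M v (window o c L)) (window o₂ c₂ L))
        (bottomDist (subwindow M v (window o c L)) (window o₂ c₂ L))) ∧
    (∀ (ι : Type) [Finite ι] (σ : SubstitutionRule ι) (T : Set (ℝ × ι)),
      IsRuleFor v w lam (window o c L) (window o₂ c₂ L) σ T → σ.Reduced →
      (IsLocal (tilingVertices v w (window o c L)) T ↔
        LengthCondition v lam L
          (topDist (subwindow M v (window o c L)) (window o₂ c₂ L))
          (bottomDist (subwindow M v (window o c L)) (window o₂ c₂ L)))) ∧
    (∀ l s : Fin 2 → ℚ,
      projY v (fun i => (l i : ℝ)) = L →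
      projY v (fun i => (s i : ℝ)) =
        projY v (M.map (Int.cast : ℤ → ℝ) *ᵥ ![0, c]) - c₂ →
      (AdmitsLocalRule v w lam (window o c L) (window o₂ c₂ L) ↔ LatticeCondition M l s)) ∧
    (|M 0 1| = 1 → latticeY v = (Algebra.adjoin ℤ {lam} : Set ℝ)) := by
  have h := isEigenData hdet hlam hmu hv hw hMv hMw
  have hc := h.isCutProject hmu
  have hlam0 : 0 < lam := by linarith
  have hEC := h.isEndImage_iff_lengthCondition hmu hL hsub
  have hder := fun hE => h.exists_derivesShapes hmu ho hE
  have hX : ∀ (b : Bool) (d : ℝ), IsDelone (tilingVertices v w (window b d L)) :=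
    fun b d => hc.isDelone b d hL
  have hocc : ∀ (b b' : Bool) (d d' : ℝ), ShapesOccurIn
      (tilingVertices v w (window b d L)) (tilingVertices v w (window b' d' L)) :=
    fun b b' d d' => hc.shapesOccurIn b b' d d' L
  have nec : ∀ (ι : Type) [Finite ι] (σ : SubstitutionRule ι) (T : Set (ℝ × ι)),
      IsRuleFor v w lam (window o c L) (window o₂ c₂ L) σ T →
      IsLocal (tilingVertices v w (window o c L)) T →
      IsEndImage (latY v) mu c L c₂ ∧ IsEndImage (latY v) mu c L (c₂ + L) :=
    fun ι _ σ T hσ hloc =>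
      ⟨hc.isEndImage_of_isLocal hlam0 h.mu_ne hL hσ.factor_eq hσ.source hσ.target hloc
        (Or.inl rfl),
      hc.isEndImage_of_isLocal hlam0 h.mu_ne hL hσ.factor_eq hσ.source hσ.target hloc
        (Or.inr rfl)⟩
  have adm : AdmitsLocalRule v w lam (window o c L) (window o₂ c₂ L) ↔
      IsEndImage (latY v) mu c L c₂ ∧ IsEndImage (latY v) mu c L (c₂ + L) := by
    constructor
    · rintro ⟨ι, hι, σ, T, hσ, hloc⟩
      exact nec ι σ T hσ hloc
    · intro hE
      obtain ⟨K, hK⟩ := hder hE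
      have hincl : ∀ x ∈ tilingVertices v w (window o c L),
          lam * x ∈ tilingVertices v w (window o₂ c₂ L) := by
        rintro _ ⟨z, hz, rfl⟩
        refine ⟨M *ᵥ z, hsub ?_, hc.U_map z⟩
        rw [h.subwindow_eq]
        exact ⟨_, hz, (hc.Y_map z).symm⟩
      obtain ⟨ι, hι, σ, T, h1, h2, h3, h4, h5⟩ := exists_local_rule hlam (hX o c) (hX o₂ c₂)
        (hc.hasFiniteComplexity o c L) hincl hK (hocc _ _ _ _) (hocc _ _ _ _)
      exact ⟨ι, hι, σ, T, ⟨h1, h2, h3, h4⟩, h5⟩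
  refine ⟨adm.trans hEC, fun ι _ σ T hσ hred => ⟨fun hloc => hEC.1 (nec ι σ T hσ hloc),
    fun hC => ?_⟩, fun l s hl hs => adm.trans (h.isEndImage_iff_latticeCondition hmu hl hs),
    h.latticeY_eq_adjoin⟩
  obtain ⟨K, hK⟩ := hder (hEC.2 hC)
  rw [← hσ.factor_eq] at hK
  exact isLocal_of_reduced (hX o₂ c₂) hσ.source hσ.target hσ.locIso.2 hK hred
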